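/- Let $X\subseteq\mathbb{R}^2$ be a set of $n\ge 2$ points. Let $L_1$ be the set of vertices (extreme points) of the convex hull of $X$ (the first convex layer of $X$), and let $L_2$ be the set of vertices of the convex hull of $X\setminus L_1$ (the second convex layer of $X$; it is empty if $X = L_1$). If \[\min\left\{\frac{3}{2}\bigl(|L_1|+|L_2|\bigr),\ \frac{4}{3}|L_1|+2|L_2|,\ 2|L_1|+|L_2|\right\}\le n,\] then the second largest among the distinct distances determined by pairs of distinct points of $X$ occurs at most $n$ times, i.e. at most $n$ unordered pairs of points of $X$ are at that distance. -/

import Mathlib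

/-- The Euclidean plane. -/
abbrev Plane : Type := EuclideanSpace ℝ (Fin 2)

/-- The first (outer) convex layer of a planar set: the vertices (extreme points) of its
convex hull. -/
def firstLayer (X : Set Plane) : Set Plane :=
  (convexHull ℝ X).extremePoints ℝ

/-- The second convex layer of a planar set: the vertices of the convex hull of what remains
after removing the first convex layer. -/
def secondLayer (X : Set Plane) : Set Plane :=
  firstLayer (X \ firstLayer X)

/-- The set of distances determined by pairs of distinct points of `X`. -/
def distances (X : Set Plane) : Set ℝ :=
  {d | ∃ p ∈ X, ∃ q ∈ X, p ≠ q ∧ dist p q = d}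

/-- `d` is the second largest distance determined by `X`: the largest of the distances that
remain when the largest distance is discarded. -/
def IsSecondLargestDistance (X : Set Plane) (d : ℝ) : Prop :=
  ∃ D, IsGreatest (distances X) D ∧ IsGreatest (distances X \ {D}) d

/-- The set of unordered pairs of distinct points of `X` at distance `d`. -/
def pairsAtDistance (X : Set Plane) (d : ℝ) : Set (Sym2 Plane) :=
  {e | ∃ p ∈ X, ∃ q ∈ X, p ≠ q ∧ dist p q = d ∧ e = s(p, q)}

/-- The multiplicity of the distance `d` in `X`: the number of unordered pairs of distinct
points of `X` at distance `d` (for finite `X`). -/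
noncomputable def multiplicityOfDistance (X : Set Plane) (d : ℝ) : ℕ :=
  (pairsAtDistance X d).ncard

/-! Let `D > d` be the two largest distances, and join points of `X` at distance `d`. A point
outside the first layer is never farthest from anything, so it has no point at distance `D`. Hence
every edge has an end in L1 and both ends in V = L1 ∪ L2 (`layers_of_dist_eq`).

Order the neighbours of each vertex from left to right. An edge that is rightmost at one of its ends
is charged to that end, so there are at most |V| of these. Any other edge qr is a "zig": it has a
neighbour a of q to its right at q and a neighbour b of r to its right at r. The path a q r b is
then a zigzag with |ab| > d, so |ab| = D (`zigzag_dist`). This determines a (`right_unique`), so a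
zig is second from the right at both ends and each vertex is on at most one zig. Thus there are at
most |V|/2 zigs, which gives 3/2 (|L1| + |L2|) edges. Since each zig has an end in L1, there are
also at most |L1| of them, which gives 2|L1| + |L2|.

In convex position, right zigs also compete with left zigs: of the points a, b belonging to a right
zig, at least one is on no left zig (`freeEnd_or_freeEnd`). So one of the two orientations has at
most n/3 zigs, and there are at most 4n/3 edges. If there are two inner points, every inner point
has degree at most 2 (`no_three_neighbors_of_inner_points`). Adding these edges to those inside L1
gives 4/3 |L1| + 2|L2|. -/

/-! ### Orientations and convex independence. -/

/-- The orientation determinant of the triangle `a b c`. -/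
def cr (a b c : Plane) : ℝ :=
  (b 0 - a 0) * (c 1 - a 1) - (b 1 - a 1) * (c 0 - a 0)

/-- `q` is not in the convex hull of the other points of `V`. -/
def ConvexIndepAt (V : Set Plane) (q : Plane) : Prop :=
  q ∉ convexHull ℝ (V \ {q})

theorem dist_sq_eq (x y : Plane) : dist x y ^ 2 = (x 0 - y 0) ^ 2 + (x 1 - y 1) ^ 2 := by
  rw [EuclideanSpace.dist_eq, Real.sq_sqrt (by positivity), Fin.sum_univ_two,
    Real.dist_eq, Real.dist_eq, sq_abs, sq_abs]

theorem plane_ext {x y : Plane} (h0 : x 0 = y 0) (h1 : x 1 = y 1) : x = y := by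
  ext i; fin_cases i <;> assumption

theorem mem_convexHull_of_weights {ι : Type*} [Fintype ι] {V : Set Plane} {q : Plane}
    (x : ι → Plane) (w : ι → ℝ) (hx : ∀ i, x i ∈ V) (hw : ∀ i, 0 ≤ w i) (hs : 0 < ∑ i, w i)
    (h0 : ∑ i, w i * (x i 0 - q 0) = 0) (h1 : ∑ i, w i * (x i 1 - q 1) = 0) :
    q ∈ convexHull ℝ V := by
  have hm := Finset.centerMass_mem_convexHull (R := ℝ) (s := V) (Finset.univ : Finset ι) (w := w)
    (fun i _ => hw i) hs (z := x) (fun i _ => hx i)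
  convert hm using 1
  have key : ∀ k : Fin 2, ∑ i, w i * (x i k - q k) = 0 →
      q k = (Finset.univ.centerMass w x) k := by
    intro k hk
    have : ∑ i, w i * x i k = (∑ i, w i) * q k := by
      rw [Finset.sum_mul, ← sub_eq_zero, ← Finset.sum_sub_distrib, ← hk]
      exact Finset.sum_congr rfl fun i _ => by ring
    simp only [Finset.centerMass, PiLp.smul_apply, WithLp.ofLp_sum, Finset.sum_apply, smul_eq_mul]
    rw [this]
    field_simp
  exact plane_ext (key 0 h0) (key 1 h1)

theorem ConvexIndepAt.mono {V W : Set Plane} {q : Plane} (h : ConvexIndepAt V q) (hW : W ⊆ V) :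
    ConvexIndepAt W q :=
  fun hq => h (convexHull_mono (Set.sdiff_subset_sdiff_left hW) hq)

theorem ConvexIndepAt.weights4 {V : Set Plane} {q : Plane} (h : ConvexIndepAt V q)
    {a b c e : Plane} (ha : a ∈ V) (hb : b ∈ V) (hc : c ∈ V) (he : e ∈ V)
    (ha' : a ≠ q) (hb' : b ≠ q) (hc' : c ≠ q) (he' : e ≠ q)
    {wa wb wc we : ℝ} (ka : 0 ≤ wa) (kb : 0 ≤ wb) (kc : 0 ≤ wc) (ke : 0 ≤ we)
    (hs : 0 < wa + wb + wc + we)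
    (h0 : wa * (a 0 - q 0) + wb * (b 0 - q 0) + wc * (c 0 - q 0) + we * (e 0 - q 0) = 0)
    (h1 : wa * (a 1 - q 1) + wb * (b 1 - q 1) + wc * (c 1 - q 1) + we * (e 1 - q 1) = 0) :
    False := by
  refine h (mem_convexHull_of_weights ![a, b, c, e] ![wa, wb, wc, we] ?_ ?_ ?_ ?_ ?_)
  · intro i; fin_cases i
    exacts [⟨ha, ha'⟩, ⟨hb, hb'⟩, ⟨hc, hc'⟩, ⟨he, he'⟩]
  · intro i; fin_cases i <;> assumption
  · simpa [Fin.sum_univ_four] using hs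
  · simpa [Fin.sum_univ_four] using h0
  · simpa [Fin.sum_univ_four] using h1

theorem ConvexIndepAt.weights3 {V : Set Plane} {q : Plane} (h : ConvexIndepAt V q)
    {a b c : Plane} (ha : a ∈ V) (hb : b ∈ V) (hc : c ∈ V)
    (ha' : a ≠ q) (hb' : b ≠ q) (hc' : c ≠ q)
    {wa wb wc : ℝ} (ka : 0 ≤ wa) (kb : 0 ≤ wb) (kc : 0 ≤ wc) (hs : 0 < wa + wb + wc)
    (h0 : wa * (a 0 - q 0) + wb * (b 0 - q 0) + wc * (c 0 - q 0) = 0)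
    (h1 : wa * (a 1 - q 1) + wb * (b 1 - q 1) + wc * (c 1 - q 1) = 0) :
    False :=
  h.weights4 ha hb hc hc ha' hb' hc' hc' ka kb kc le_rfl (by linarith) (by linarith)
    (by linarith)

theorem cr_swap (a b c : Plane) : cr a c b = -cr a b c := by unfold cr; ring

theorem cr_rotate (a b c : Plane) : cr b c a = cr a b c := by unfold cr; ring

theorem cr_self (a b : Plane) : cr a b b = 0 := by unfold cr; ring

/-- A convexly independent point is in no triangle, in terms of orientations. -/
theorem ConvexIndepAt.not_cyclic {V : Set Plane} {q : Plane} (h : ConvexIndepAt V q)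
    {a b c : Plane} (ha : a ∈ V) (hb : b ∈ V) (hc : c ∈ V)
    (ha' : a ≠ q) (hb' : b ≠ q) (hc' : c ≠ q) {s : ℝ}
    (h1 : 0 < s * cr q a b) (h2 : 0 ≤ s * cr q b c) (h3 : 0 ≤ s * cr q c a) : False :=
  h.weights3 ha hb hc ha' hb' hc' h2 h3 h1.le (by linarith)
    (by unfold cr; ring) (by unfold cr; ring)

theorem eq_or_eq_neg_of_parallel {x y z w k : ℝ} (h1 : x ^ 2 + y ^ 2 = k) (h2 : z ^ 2 + w ^ 2 = k)
    (h0 : x * w - y * z = 0) : (x = z ∧ y = w) ∨ (x + z = 0 ∧ y + w = 0) := by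
  -- Lagrange's identity: the squares of dot product and determinant add up to k².
  have hp : (k - (x * z + y * w)) * (k + (x * z + y * w)) = 0 := by
    linear_combination (-k) * h1 - (x ^ 2 + y ^ 2) * h2 + (x * w - y * z) * h0
  rcases mul_eq_zero.1 hp with hp | hp
  · left
    have h3 : (x - z) ^ 2 + (y - w) ^ 2 = 0 := by linear_combination h1 + h2 + 2 * hp
    have h4 : (x - z) ^ 2 = 0 := by linarith [sq_nonneg (x - z), sq_nonneg (y - w)]
    have h5 : (y - w) ^ 2 = 0 := by linarith [sq_nonneg (x - z), sq_nonneg (y - w)]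
    exact ⟨sub_eq_zero.1 (pow_eq_zero_iff two_ne_zero |>.1 h4),
      sub_eq_zero.1 (pow_eq_zero_iff two_ne_zero |>.1 h5)⟩
  · right
    have h3 : (x + z) ^ 2 + (y + w) ^ 2 = 0 := by linear_combination h1 + h2 + 2 * hp
    have h4 : (x + z) ^ 2 = 0 := by linarith [sq_nonneg (x + z), sq_nonneg (y + w)]
    have h5 : (y + w) ^ 2 = 0 := by linarith [sq_nonneg (x + z), sq_nonneg (y + w)]
    exact ⟨pow_eq_zero_iff two_ne_zero |>.1 h4, pow_eq_zero_iff two_ne_zero |>.1 h5⟩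

/-- Two vectors of equal length from `q` with vanishing determinant are equal or opposite. -/
theorem eq_or_opposite_of_cr_eq_zero {q a b : Plane} (h : dist q a = dist q b)
    (h0 : cr q a b = 0) :
    a = b ∨ (a 0 - q 0 + (b 0 - q 0) = 0 ∧ a 1 - q 1 + (b 1 - q 1) = 0) := by
  have ea := dist_sq_eq q a
  have eb := dist_sq_eq q b
  rw [h] at ea
  rcases eq_or_eq_neg_of_parallel (k := dist q b ^ 2) (x := a 0 - q 0) (y := a 1 - q 1)
    (z := b 0 - q 0) (w := b 1 - q 1) (by rw [ea]; ring) (by rw [eb]; ring) h0 with h | h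
  · exact Or.inl (plane_ext (by linarith [h.1]) (by linarith [h.2]))
  · exact Or.inr h

/-- Neighbours of a convexly independent point on a circle about it are not collinear with it. -/
theorem ConvexIndepAt.cr_ne_zero {V : Set Plane} {q : Plane} (h : ConvexIndepAt V q)
    {a b : Plane} (ha : a ∈ V) (hb : b ∈ V) {d : ℝ} (hd : 0 < d)
    (hqa : dist q a = d) (hqb : dist q b = d) (hab : a ≠ b) : cr q a b ≠ 0 := by
  intro h0
  have haq : a ≠ q := by rintro rfl; simp at hqa; linarith
  have hbq : b ≠ q := by rintro rfl; simp at hqb; linarith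
  rcases eq_or_opposite_of_cr_eq_zero (hqa.trans hqb.symm) h0 with h1 | h1
  · exact hab h1
  · exact h.weights3 ha hb hb haq hbq hbq (zero_le_one' ℝ) (zero_le_one' ℝ) le_rfl (by norm_num)
      (by linarith [h1.1]) (by linarith [h1.2])

/-! ### Zigzags of three equal edges. -/

theorem zigzag_sq {x y u v z w k : ℝ} (hk : 0 < k) (f1 : x ^ 2 + y ^ 2 = k)
    (f2 : u ^ 2 + v ^ 2 = k) (f3 : z ^ 2 + w ^ 2 = k)
    (h : (x * v - y * u) * (x * w - y * z) < 0) : k < (u - x - z) ^ 2 + (v - y - w) ^ 2 := by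
  have h1 : x * u + y * v ≤ k := by linarith [sq_nonneg (x - u), sq_nonneg (y - v)]
  have h2 : -k ≤ x * z + y * w := by linarith [sq_nonneg (x + z), sq_nonneg (y + w)]
  have h3 : 0 ≤ (k - (x * u + y * v)) * (k + (x * z + y * w)) :=
    mul_nonneg (by linarith) (by linarith)
  have h4 : k * (u * z + v * w) =
      (x * u + y * v) * (x * z + y * w) + (x * v - y * u) * (x * w - y * z) := by
    rw [← f1]; ring
  -- Both factors of the first product are nonnegative by Cauchy–Schwarz; the product of
  -- determinants is negative because the outer points lie on opposite sides of the base.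
  have h5 : k * ((u - x - z) ^ 2 + (v - y - w) ^ 2 - k) =
      2 * ((k - (x * u + y * v)) * (k + (x * z + y * w))
        - (x * v - y * u) * (x * w - y * z)) := by
    linear_combination k * f1 + k * f2 + k * f3 - 2 * h4
  have h6 : 0 < k * ((u - x - z) ^ 2 + (v - y - w) ^ 2 - k) := by rw [h5]; linarith
  linarith [(mul_pos_iff_of_pos_left hk).1 h6]

theorem zigzag_dist {s d : ℝ} (hd : 0 < d) {q r a b : Plane} (hs : s * s = 1)
    (hqr : dist q r = d) (hqa : dist q a = d) (hrb : dist r b = d)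
    (ha : s * cr q r a < 0) (hb : s * cr r q b < 0) : d < dist a b := by
  have e1 := dist_sq_eq q r
  have e2 := dist_sq_eq q a
  have e3 := dist_sq_eq r b
  have e4 := dist_sq_eq a b
  rw [hqr] at e1; rw [hqa] at e2; rw [hrb] at e3
  have hprod : 0 < cr q r a * cr r q b := by
    have := mul_pos_of_neg_of_neg ha hb
    calc 0 < _ := this
      _ = (s * s) * (cr q r a * cr r q b) := by ring
      _ = _ := by rw [hs, one_mul]
  have key := zigzag_sq (x := r 0 - q 0) (y := r 1 - q 1) (u := a 0 - q 0) (v := a 1 - q 1)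
    (z := b 0 - r 0) (w := b 1 - r 1) (k := d ^ 2) (by positivity) (by rw [e1]; ring)
    (by rw [e2]; ring) (by rw [e3]; ring) (by unfold cr at hprod; linarith)
  refine lt_of_pow_lt_pow_left₀ 2 dist_nonneg ?_
  rw [e4]
  linear_combination key

/-- `a` lies to the right of `r` seen from `q` (to the left if `s = -1`). -/
def RightOf (s : ℝ) (q r a : Plane) : Prop := s * cr q r a < 0

/-- Two distinct points equidistant from `q` and from `b` are mirror images in the line `q b`. -/
theorem cr_reflected {q b a a' : Plane} (hqb : q ≠ b) (h1 : dist q a = dist q a')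
    (h2 : dist b a = dist b a') (hne : a ≠ a') :
    cr q b a' = -cr q b a ∧ cr q b a ≠ 0 := by
  have e1 := dist_sq_eq q a
  have e2 := dist_sq_eq q a'
  have e3 := dist_sq_eq b a
  have e4 := dist_sq_eq b a'
  have e5 := dist_sq_eq q b
  have hpos : 0 < dist q b ^ 2 := by have := dist_pos.2 hqb; positivity
  rw [h1, e2] at e1
  rw [h2, e4] at e3
  rw [e5] at hpos
  have hdot : (b 0 - q 0) * (a 0 - a' 0) + (b 1 - q 1) * (a 1 - a' 1) = 0 := by
    linear_combination (1 / 2) * e3 - (1 / 2) * e1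
  have hor : (cr q b a - cr q b a') * (cr q b a + cr q b a') = 0 := by
    unfold cr
    linear_combination (-((q 0 - b 0) ^ 2 + (q 1 - b 1) ^ 2)) * e1
      - ((b 0 - q 0) * (a 0 - q 0 + (a' 0 - q 0)) + (b 1 - q 1) * (a 1 - q 1 + (a' 1 - q 1))) * hdot
  have hcr : cr q b a - cr q b a' ≠ 0 := by
    intro h0
    apply hne
    unfold cr at h0
    have x0 : ((q 0 - b 0) ^ 2 + (q 1 - b 1) ^ 2) * (a 0 - a' 0) = 0 := by
      linear_combination (b 0 - q 0) * hdot - (b 1 - q 1) * h0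
    have x1 : ((q 0 - b 0) ^ 2 + (q 1 - b 1) ^ 2) * (a 1 - a' 1) = 0 := by
      linear_combination (b 1 - q 1) * hdot + (b 0 - q 0) * h0
    exact plane_ext (sub_eq_zero.1 ((mul_eq_zero.1 x0).resolve_left hpos.ne'))
      (sub_eq_zero.1 ((mul_eq_zero.1 x1).resolve_left hpos.ne'))
  have hsum := (mul_eq_zero.1 hor).resolve_left hcr
  exact ⟨by linarith, fun h0 => hcr (by linarith)⟩

theorem ne_of_dist_eq {x y : Plane} {d : ℝ} (hd : 0 < d) (h : dist x y = d) : x ≠ y := by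
  rintro rfl; simp at h; linarith

theorem RightOf.swap_base {s : ℝ} {q r a : Plane} (h : RightOf s q r a) : 0 < s * cr r q a := by
  unfold RightOf at h
  have : cr r q a = -cr q r a := by unfold cr; ring
  rw [this]; linarith

/-- Otherwise `a` and `a'` are mirror images in the line `q b`. The one on the side of that line
away from `r` forms with `r` and `b` a triangle containing `q`. -/
theorem right_unique {V : Set Plane} {s d : ℝ} (hd : 0 < d) {q r a a' b : Plane}
    (hq : ConvexIndepAt V q) (hr : r ∈ V) (ha : a ∈ V) (ha' : a' ∈ V) (hb : b ∈ V)
    (hqr : dist q r = d) (hqa : dist q a = d) (hqa' : dist q a' = d)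
    (h1 : RightOf s q r a) (h2 : RightOf s q r a') (h3 : RightOf s r q b)
    (hab : dist b a = dist b a') : a = a' := by
  by_contra hne
  have hqb : q ≠ b := by
    rintro rfl; simp [RightOf, cr_self] at h3
  have hrq : r ≠ q := (ne_of_dist_eq hd hqr).symm
  obtain ⟨hc, hc0⟩ := cr_reflected hqb (hqa.trans hqa'.symm) hab hne
  have hb1 := h3.swap_base
  unfold RightOf at h1 h2
  rcases le_total 0 (s * cr q b a) with h | h
  · refine hq.not_cyclic (s := s) ha hr hb (ne_of_dist_eq hd hqa).symm hrq hqb.symm ?_ hb1.le h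
    rw [cr_swap]; linarith
  · refine hq.not_cyclic (s := s) ha' hr hb (ne_of_dist_eq hd hqa').symm hrq hqb.symm ?_ hb1.le ?_
    · rw [cr_swap]; linarith
    · rw [hc]; linarith

/-! ### Convex position: comparing the two end angles of a zigzag. -/

/-- Diagonals of a convexly independent quadrilateral meet. -/
theorem exists_crossing {V : Set Plane} {s : ℝ} {a b c e : Plane}
    (hIa : ConvexIndepAt V a) (hIb : ConvexIndepAt V b) (ha : a ∈ V) (hb : b ∈ V) (hc : c ∈ V)
    (he : e ∈ V) (hab : a ≠ b) (hca : c ≠ a) (hcb : c ≠ b)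
    (h1 : 0 ≤ s * cr a b c) (h2 : s * cr a b e < 0) :
    ∃ t u : ℝ, 0 < t ∧ t < 1 ∧ 0 ≤ u ∧ u < 1 ∧
      a 0 + t * (b 0 - a 0) = c 0 + u * (e 0 - c 0) ∧
      a 1 + t * (b 1 - a 1) = c 1 + u * (e 1 - c 1) := by
  have hea : e ≠ a := by rintro rfl; simp [cr] at h2
  have heb : e ≠ b := by rintro rfl; simp [cr_self] at h2
  have hP : s * cr a c e < 0 := by
    by_contra! h
    refine hIa.not_cyclic (s := s) he hb hc hea hab.symm hca ?_ h1 h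
    rw [cr_swap]; linarith
  have hQ : s * cr b e c < 0 := by
    by_contra! h
    refine hIb.not_cyclic (s := s) ha he hc hab heb hcb ?_ h ?_
    · have : cr b a e = -cr a b e := by unfold cr; ring
      rw [this]; linarith
    · rw [cr_rotate]; exact h1
  set P := -(s * cr a c e) with hPd
  set Q := -(s * cr b e c) with hQd
  set C := s * cr a b c with hCd
  set E := -(s * cr a b e) with hEd
  have hsum : P + Q = C + E := by rw [hPd, hQd, hCd, hEd]; unfold cr; ring
  have hpos : 0 < P + Q := by linarith
  have hpos' : 0 < C + E := by linarith
  refine ⟨P / (P + Q), C / (C + E), by apply div_pos <;> linarith, ?_, div_nonneg h1 (by linarith),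
    ?_, ?_, ?_⟩
  · rw [div_lt_one hpos]; linarith
  · rw [div_lt_one hpos']; linarith
  · rw [← hsum]; field_simp
    rw [hPd, hQd, hCd]; unfold cr; ring
  · rw [← hsum]; field_simp
    rw [hPd, hQd, hCd]; unfold cr; ring

theorem add_dist_lt_of_crossing {V : Set Plane} {s : ℝ} {a b c e : Plane}
    (hIa : ConvexIndepAt V a) (hIb : ConvexIndepAt V b) (ha : a ∈ V) (hb : b ∈ V) (hc : c ∈ V)
    (he : e ∈ V) (hab : a ≠ b) (hca : c ≠ a) (hcb : c ≠ b)
    (h1 : 0 ≤ s * cr a b c) (h2 : s * cr a b e < 0) :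
    dist a c + dist b e < dist a b + dist c e := by
  obtain ⟨t, u, ht0, ht1, hu0, hu1, k0, k1⟩ :=
    exists_crossing hIa hIb ha hb hc he hab hca hcb h1 h2
  set m : Plane := AffineMap.lineMap a b t with hm
  have hm0 : m 0 = a 0 + t * (b 0 - a 0) := by
    simp [hm, AffineMap.lineMap_apply]; ring
  have hm1 : m 1 = a 1 + t * (b 1 - a 1) := by
    simp [hm, AffineMap.lineMap_apply]; ring
  have hm' : m = AffineMap.lineMap c e u := by
    apply plane_ext
    · rw [hm0, k0]; simp [AffineMap.lineMap_apply]; ring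
    · rw [hm1, k1]; simp [AffineMap.lineMap_apply]; ring
  have w1 : Wbtw ℝ a m b := ⟨t, ⟨ht0.le, ht1.le⟩, rfl⟩
  have w2 : Wbtw ℝ c m e := ⟨u, ⟨hu0, hu1.le⟩, hm'.symm⟩
  have d1 := w1.dist_add_dist
  have d2 := w2.dist_add_dist
  have d3 := dist_triangle a m c
  -- Equality would put the crossing point `m` on segment `b e`; as `m ≠ b` lies on line `a b`, then
  -- `e` would too.
  have d4 : dist b e < dist b m + dist m e := by
    refine lt_of_le_of_ne (dist_triangle b m e) fun h => ?_
    have w3 : Wbtw ℝ b m e := dist_add_dist_eq_iff.1 h.symm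
    obtain ⟨v, -, hv⟩ := w3
    have v0 : m 0 = b 0 + v * (e 0 - b 0) := by
      rw [← hv]; simp [AffineMap.lineMap_apply]; ring
    have v1 : m 1 = b 1 + v * (e 1 - b 1) := by
      rw [← hv]; simp [AffineMap.lineMap_apply]; ring
    have : (1 - t) * cr a b e = 0 := by
      rw [hm0] at v0; rw [hm1] at v1
      unfold cr
      linear_combination (e 0 - b 0) * v1 - (e 1 - b 1) * v0
    rcases mul_eq_zero.1 this with h | h
    · linarith
    · rw [h] at h2; simp at h2
  rw [dist_comm m c] at d3
  rw [dist_comm b m] at d4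
  linarith

/-- For a zigzag a q r b with angles φ at q and ψ at r, the triangle q r b is isosceles, so angle
aqb is φ + 90° − ψ/2. If that is acute then φ < ψ/2, whence |ar| < |qb|. Below, α = k cos φ and γ =
−k cos ψ. -/
theorem inner_sign_of_short {x y u v z w k : ℝ} (f1 : x ^ 2 + y ^ 2 = k)
    (f2 : u ^ 2 + v ^ 2 = k) (f3 : z ^ 2 + w ^ 2 = k)
    (h : (x * v - y * u) * (x * w - y * z) < 0) (hpos : 0 < u * (x + z) + v * (y + w)) :
    (u - x) ^ 2 + (v - y) ^ 2 < (x + z) ^ 2 + (y + w) ^ 2 := by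
  have hk : 0 < k := by
    rcases (by rw [← f1]; positivity : 0 ≤ k).eq_or_lt with h0 | h0
    · exfalso
      have hx : x = 0 := by nlinarith [sq_nonneg x, sq_nonneg y]
      have hy : y = 0 := by nlinarith [sq_nonneg x, sq_nonneg y]
      rw [hx, hy] at h; simp at h
    · exact h0
  obtain ⟨α, hα⟩ : ∃ α, α = x * u + y * v := ⟨_, rfl⟩
  obtain ⟨β, hβ⟩ : ∃ β, β = x * v - y * u := ⟨_, rfl⟩
  obtain ⟨γ, hγ⟩ : ∃ γ, γ = x * z + y * w := ⟨_, rfl⟩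
  obtain ⟨δ, hδ⟩ : ∃ δ, δ = x * w - y * z := ⟨_, rfl⟩
  have n1 : α ^ 2 + β ^ 2 = k ^ 2 := by
    rw [hα, hβ]; linear_combination (u ^ 2 + v ^ 2) * f1 + k * f2
  have n2 : γ ^ 2 + δ ^ 2 = k ^ 2 := by
    rw [hγ, hδ]; linear_combination (z ^ 2 + w ^ 2) * f1 + k * f3
  have hin : 0 < α * (k + γ) + β * δ := by
    have : α * (k + γ) + β * δ = k * (u * (x + z) + v * (y + w)) := by
      rw [hα, hβ, hγ, hδ]; linear_combination (u * z + v * w) * f1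
    rw [this]; positivity
  rw [← hβ, ← hδ] at h
  have hαk : α ≤ k := by nlinarith [sq_nonneg β]
  have hγk : 0 ≤ k + γ := by nlinarith [sq_nonneg δ]
  suffices hs : 0 < α + γ by
    rw [hα, hγ] at hs
    linarith [f1, f2, f3]
  by_contra! hneg
  have hαpos : 0 < α := by
    by_contra! h0
    nlinarith [mul_nonneg (neg_nonneg.2 h0) hγk]
  have hsq : δ ^ 2 ≤ β ^ 2 := by nlinarith
  have habs : δ ^ 2 ≤ -(β * δ) := by
    have h1 : (δ ^ 2) ^ 2 ≤ (-(β * δ)) ^ 2 := by nlinarith [sq_nonneg δ]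
    exact (pow_le_pow_iff_left₀ (sq_nonneg _) (by linarith) two_ne_zero).1 h1
  have h2 : (k - γ) * (k + γ) < α * (k + γ) := by nlinarith
  nlinarith

/-- With the origin at q: if the angle at q between a and b were not acute, no point of the ray
towards b would be closer to a than q is. Here the point `u • b` is closer. -/
theorem inner_pos_of_shorter {k t u a0 a1 b0 b1 p0 p1 : ℝ} (hk : 0 < k) (ht0 : 0 < t) (ht1 : t < 1)
    (hu : 0 ≤ u) (h1 : a0 ^ 2 + a1 ^ 2 = k) (h2 : p0 ^ 2 + p1 ^ 2 = k)
    (g0 : t * p0 = -a0 + u * b0) (g1 : t * p1 = -a1 + u * b1) : 0 < a0 * b0 + a1 * b1 := by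
  have e : t ^ 2 * k = k - 2 * (u * (a0 * b0 + a1 * b1)) + u ^ 2 * (b0 ^ 2 + b1 ^ 2) := by
    calc t ^ 2 * k = (t * p0) ^ 2 + (t * p1) ^ 2 := by rw [← h2]; ring
      _ = _ := by rw [g0, g1, ← h1]; ring
  have h3 : t ^ 2 * k < k := by
    have : t ^ 2 < 1 := by nlinarith
    nlinarith
  by_contra! h4
  have h5 : 0 ≤ u * -(a0 * b0 + a1 * b1) := mul_nonneg hu (by linarith)
  have h6 : 0 ≤ u ^ 2 * (b0 ^ 2 + b1 ^ 2) := by positivity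
  linarith

/-- If `a` has a second neighbour `p` lying between `q` and `b`, then the end angle at `q` of the
zigzag `a q r b` is smaller than the one at `r`. -/
theorem dist_lt_of_second_left {V : Set Plane} {s d D : ℝ} (hs : s * s = 1) (hd : 0 < d)
    (hdD : d < D) (hI : ∀ v ∈ V, ConvexIndepAt V v) (hD : ∀ x ∈ V, ∀ y ∈ V, dist x y ≤ D)
    {q r a b p l : Plane} (hqV : q ∈ V) (haV : a ∈ V) (hbV : b ∈ V)
    (hpV : p ∈ V) (hlV : l ∈ V) (hqr : dist q r = d) (hqa : dist q a = d) (hrb : dist r b = d)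
    (hap : dist a p = d) (hpl : dist p l = d) (hab : dist a b = D)
    (ha : RightOf s q r a) (hb : RightOf s r q b) (hp : RightOf s a q p) (hl : RightOf s p l a) :
    dist a r < dist q b := by
  have hap' : a ≠ p := ne_of_dist_eq hd hap
  have hba : b ≠ a := (ne_of_dist_eq (hd.trans hdD) hab).symm
  have hbp : b ≠ p := by rintro rfl; linarith
  have hqb : b ≠ q := by rintro rfl; simp [RightOf, cr_self] at hb
  have hqa' : q ≠ a := ne_of_dist_eq hd hqa
  have hqp : q ≠ p := by rintro rfl; simp [RightOf, cr_self] at hp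
  unfold RightOf at hp hl
  have hl' : s * cr a p l < 0 := by rwa [cr_rotate] at hl
  -- Otherwise `a p` and `b l` are crossing diagonals, and D + d = |ab| + |pl| < |ap| + |bl| ≤ d +
  -- D.
  have hside : s * cr a p b < 0 := by
    by_contra! h
    have := add_dist_lt_of_crossing (hI a haV) (hI p hpV) haV hpV hbV hlV hap' hba hbp h hl'
    have h2 := hD b hbV l hlV
    linarith
  have hside' : 0 ≤ s * cr a p q := by rw [cr_swap]; linarith
  -- So `a p` crosses `q b` at a distance less than d = |aq| from `a`, which makes angle `a q b`
  -- acute.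
  obtain ⟨t, u, ht0, ht1, hu0, hu1, k0, k1⟩ :=
    exists_crossing (hI a haV) (hI p hpV) haV hpV hqV hbV hap' hqa' hqp hside' hside
  have eap := dist_sq_eq a p
  have eqa := dist_sq_eq q a
  have eqr := dist_sq_eq q r
  have erb := dist_sq_eq r b
  have ear := dist_sq_eq a r
  have eqb := dist_sq_eq q b
  rw [hap] at eap; rw [hqa] at eqa; rw [hqr] at eqr; rw [hrb] at erb
  have hdd : 0 < d ^ 2 := by positivity
  have hin : 0 < (a 0 - q 0) * (b 0 - q 0) + (a 1 - q 1) * (b 1 - q 1) := by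
    refine inner_pos_of_shorter (k := d ^ 2) (p0 := p 0 - a 0) (p1 := p 1 - a 1) (t := t) (u := u)
      (by positivity) ht0 ht1 hu0 (by rw [eqa]; ring) (by rw [eap]; ring) ?_ ?_
    · linear_combination k0
    · linear_combination k1
  have hprod : 0 < cr q r a * cr r q b := by
    have := mul_pos_of_neg_of_neg ha hb
    calc 0 < _ := this
      _ = (s * s) * (cr q r a * cr r q b) := by ring
      _ = _ := by rw [hs, one_mul]
  have key := inner_sign_of_short (x := r 0 - q 0) (y := r 1 - q 1) (u := a 0 - q 0)
    (v := a 1 - q 1) (z := b 0 - r 0) (w := b 1 - r 1) (k := d ^ 2) (by rw [eqr]; ring)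
    (by rw [eqa]; ring) (by rw [erb]; ring) (by unfold cr at hprod; linarith)
    (by ring_nf at hin ⊢; linarith)
  refine lt_of_pow_lt_pow_left₀ 2 dist_nonneg ?_
  rw [ear, eqb]
  linear_combination key

/-- Real form of `dist_lt_of_left`: `κ`, `z`, `z'` are the coordinates of the two outer points in
the frame given by the base of length `√N`. -/
theorem trapezoid_bound {s N T κ z z' : ℝ} (hs : s * s = 1) (hκ : 0 < κ)
    (h1 : κ ^ 2 + z ^ 2 = N * κ + T * z) (h2 : κ ^ 2 + z' ^ 2 = N * κ + T * z')
    (hz : 0 < s * (z + z')) (b1 : s * (z - T / 2) < 0) (b2 : s * (z' - T / 2) < 0) :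
    N < κ ∧ 0 < T * z := by
  have hne : z + z' - T ≠ 0 := by
    intro h
    have : s * (z + z' - T) < 0 := by linarith
    rw [h] at this; simp at this
  -- Both are roots of the same quadratic, and their sum is not T.
  have hzz : z = z' := by
    have : (z - z') * (z + z' - T) = 0 := by linear_combination h1 - h2
    exact sub_eq_zero.1 ((mul_eq_zero.1 this).resolve_right hne)
  subst hzz
  have p1 : 0 < s * z := by linarith
  have p2 : 0 < s * (T - z) := by linarith
  have p3 : 0 < z * (T - z) := by
    have := mul_pos p1 p2
    calc 0 < _ := this
      _ = (s * s) * (z * (T - z)) := by ring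
      _ = _ := by rw [hs, one_mul]
  constructor
  · by_contra! h
    nlinarith
  · nlinarith [sq_nonneg z]

/-- Since |rb| = |ax| = d and |ab| = |rx| = D, the triangles `r b a` and `a x r` are congruent.
Convexity places `b` and `x` so that they are mirror images in the bisector of `a r`, and this
isosceles trapezoid makes `q b` longer than `a r`. -/
theorem dist_lt_of_left {V : Set Plane} {s d D : ℝ} (hs : s * s = 1) (hd : 0 < d)
    (hdD : d < D) (hI : ∀ v ∈ V, ConvexIndepAt V v)
    {q r a b x : Plane} (hqV : q ∈ V) (hrV : r ∈ V) (haV : a ∈ V) (hbV : b ∈ V) (hxV : x ∈ V)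
    (hqr : dist q r = d) (hqa : dist q a = d) (hrb : dist r b = d) (hax : dist a x = d)
    (hab : dist a b = D) (hrx : dist r x = D)
    (ha : RightOf s q r a) (hb : RightOf s r q b) (hx : RightOf s a x q) :
    dist a r < dist q b := by
  have hqb : b ≠ q := by rintro rfl; simp [RightOf, cr_self] at hb
  have hqx : x ≠ q := by rintro rfl; simp [RightOf, cr_self] at hx
  have hra : r ≠ a := by rintro rfl; simp [RightOf, cr_self] at ha
  have hqr' := ne_of_dist_eq hd hqr
  have hqa' := ne_of_dist_eq hd hqa
  have hrb' := ne_of_dist_eq hd hrb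
  have hax' := ne_of_dist_eq hd hax
  have eqa := dist_sq_eq q a
  have eqr := dist_sq_eq q r
  have erb := dist_sq_eq r b
  have eax := dist_sq_eq a x
  have eab := dist_sq_eq a b
  have erx := dist_sq_eq r x
  have ear := dist_sq_eq a r
  have eqb := dist_sq_eq q b
  have hDd : d ^ 2 < D ^ 2 := by gcongr
  rw [hqa] at eqa; rw [hqr] at eqr; rw [hrb] at erb; rw [hax] at eax; rw [hab] at eab
  rw [hrx] at erx
  unfold RightOf at ha hb hx
  have c1 : s * cr r a b < 0 := by
    by_contra! h
    refine (hI r hrV).not_cyclic (s := s) hbV hqV haV hrb'.symm hqr' hra.symm ?_ ?_ h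
    · rw [cr_swap]; linarith
    · have h3 : cr r q a = -cr q r a := by unfold cr; ring
      rw [h3]; linarith only [ha]
  have c2 : s * cr a x r < 0 := by
    by_contra! h
    have h3 : cr a r q = -cr q r a := by unfold cr; ring
    have h4 : cr a q x = -cr a x q := cr_swap _ _ _
    refine (hI a haV).not_cyclic (s := s) hrV hqV hxV hra hqa' hax'.symm ?_ ?_ h
    · rw [h3]; linarith
    · rw [h4]; linarith
  -- Frame with origin `q`: e runs along `r a`, and f, the sum of the vectors to `a` and `r`, is
  -- orthogonal to e because |qa| = |qr|.
  obtain ⟨e0, he0⟩ : ∃ e0, e0 = a 0 - r 0 := ⟨_, rfl⟩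
  obtain ⟨e1, he1⟩ : ∃ e1, e1 = a 1 - r 1 := ⟨_, rfl⟩
  obtain ⟨f0, hf0⟩ : ∃ f0, f0 = a 0 - q 0 + (r 0 - q 0) := ⟨_, rfl⟩
  obtain ⟨f1, hf1⟩ : ∃ f1, f1 = a 1 - q 1 + (r 1 - q 1) := ⟨_, rfl⟩
  obtain ⟨b0, hb0⟩ : ∃ b0, b0 = b 0 - q 0 := ⟨_, rfl⟩
  obtain ⟨b1, hb1⟩ : ∃ b1, b1 = b 1 - q 1 := ⟨_, rfl⟩
  obtain ⟨x0, hx0⟩ : ∃ x0, x0 = x 0 - q 0 := ⟨_, rfl⟩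
  obtain ⟨x1, hx1⟩ : ∃ x1, x1 = x 1 - q 1 := ⟨_, rfl⟩
  have hef : e0 * f0 + e1 * f1 = 0 := by
    rw [he0, he1, hf0, hf1]; linear_combination eqr - eqa
  have hbb : b0 ^ 2 + b1 ^ 2 = b0 * (f0 - e0) + b1 * (f1 - e1) := by
    rw [he0, he1, hf0, hf1, hb0, hb1]; linear_combination eqr - erb
  have hxx : x0 ^ 2 + x1 ^ 2 = x0 * (f0 + e0) + x1 * (f1 + e1) := by
    rw [he0, he1, hf0, hf1, hx0, hx1]; linear_combination eqa - eax
  have hκ : D ^ 2 - d ^ 2 = -2 * (b0 * e0 + b1 * e1) := by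
    rw [eab, hb0, hb1, he0, he1]; linear_combination eqr - eqa - erb
  have hκ' : D ^ 2 - d ^ 2 = 2 * (x0 * e0 + x1 * e1) := by
    rw [erx, hx0, hx1, he0, he1]; linear_combination eqa - eqr - eax
  have hT : e0 * f1 - e1 * f0 = -2 * cr q r a := by
    rw [he0, he1, hf0, hf1]; unfold cr; ring
  have hbT : cr r a b = (e0 * b1 - e1 * b0) - (e0 * f1 - e1 * f0) / 2 := by
    rw [he0, he1, hf0, hf1, hb0, hb1]; unfold cr; ring
  have hxT : cr a x r = (e0 * x1 - e1 * x0) - (e0 * f1 - e1 * f0) / 2 := by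
    rw [he0, he1, hf0, hf1, hx0, hx1]; unfold cr; ring
  -- The vectors to `b` and `x` add up to a multiple of f. If that multiple is not positive, `q` is
  -- a convex combination of `b`, `x`, `r` and `a`.
  have hsum : 0 < s * ((e0 * b1 - e1 * b0) + (e0 * x1 - e1 * x0)) := by
    by_contra! h
    have hve : (b0 + x0) * e0 + (b1 + x1) * e1 = 0 := by linarith
    have hTpos : 0 < s * (e0 * f1 - e1 * f0) := by rw [hT]; linarith
    refine (hI q hqV).weights4 hbV hxV hrV haV hqb hqx hqr'.symm hqa'.symm hTpos.le hTpos.le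
      (wc := -(s * ((e0 * b1 - e1 * b0) + (e0 * x1 - e1 * x0))))
      (we := -(s * ((e0 * b1 - e1 * b0) + (e0 * x1 - e1 * x0))))
      (by linarith) (by linarith) (by linarith) ?_ ?_
    · rw [← hb0, ← hx0]
      have : r 0 - q 0 = f0 - (a 0 - q 0) := by rw [hf0]; ring
      rw [this]
      linear_combination s * f1 * hve - s * (b1 + x1) * hef
    · rw [← hb1, ← hx1]
      have : r 1 - q 1 = f1 - (a 1 - q 1) := by rw [hf1]; ring
      rw [this]
      linear_combination s * (b0 + x0) * hef - s * f0 * hve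
  obtain ⟨r1, r2⟩ := trapezoid_bound (s := s) (N := e0 ^ 2 + e1 ^ 2) (T := e0 * f1 - e1 * f0)
    (κ := (D ^ 2 - d ^ 2) / 2) (z := e0 * b1 - e1 * b0) (z' := e0 * x1 - e1 * x0) hs
    (by linarith)
    (by
      have : (D ^ 2 - d ^ 2) / 2 = -(b0 * e0 + b1 * e1) := by linarith
      rw [this]
      linear_combination (e0 ^ 2 + e1 ^ 2) * hbb + (b0 * e0 + b1 * e1) * hef)
    (by
      have : (D ^ 2 - d ^ 2) / 2 = x0 * e0 + x1 * e1 := by linarith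
      rw [this]
      linear_combination (e0 ^ 2 + e1 ^ 2) * hxx + (x0 * e0 + x1 * e1) * hef)
    hsum (by rw [← hbT]; exact c1) (by rw [← hxT]; exact c2)
  have hN : 0 ≤ e0 ^ 2 + e1 ^ 2 := by positivity
  have hNb : (e0 ^ 2 + e1 ^ 2) * (b0 ^ 2 + b1 ^ 2) =
      (e0 ^ 2 + e1 ^ 2) * ((D ^ 2 - d ^ 2) / 2) +
        (e0 * f1 - e1 * f0) * (e0 * b1 - e1 * b0) := by
    have : (D ^ 2 - d ^ 2) / 2 = -(b0 * e0 + b1 * e1) := by linarith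
    rw [this]
    linear_combination (e0 ^ 2 + e1 ^ 2) * hbb + (b0 * e0 + b1 * e1) * hef
  refine lt_of_pow_lt_pow_left₀ 2 dist_nonneg ?_
  have h1 : dist a r ^ 2 = e0 ^ 2 + e1 ^ 2 := by rw [ear, he0, he1]
  have h2 : dist q b ^ 2 = b0 ^ 2 + b1 ^ 2 := by rw [eqb, hb0, hb1]; ring
  rw [h1, h2]
  by_contra! h
  have h3 := mul_le_mul_of_nonneg_left h hN
  have h4 := mul_le_mul_of_nonneg_left r1.le hN
  linarith

/-! ### Three neighbours of one point. -/

/-- The case |u₁v| = |u₂v| of `not_between_of_far`, with u₂ = a u₁ + b u₃ seen from p, `g` the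
products of the uᵢ, `m` their products with v, and w = |v|². A product equals C at distance D. The
inequalities force a > 1, angles u₁u₂ and u₂u₃ at most 60°, and angle u₁u₃ obtuse; but a =
sin(u₂u₃)/sin(u₁u₃) ≤ 1 for such angles. -/
theorem no_middle_scalar {k C a b g12 g13 g23 m1 m2 m3 w : ℝ} (hk : 0 < k) (ha : 0 < a)
    (hb : 0 < b) (e12 : g12 = a * k + b * g13) (e23 : g23 = a * g13 + b * k)
    (e2 : k = a * g12 + b * g23) (em : m2 = a * m1 + b * m3) (hw : 0 < w)
    (h1 : m1 = m2) (h2 : m2 ≤ 0) (h3 : w / 2 ≤ m3 ∨ m3 = m2)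
    (k12 : k / 2 ≤ g12 ∨ g12 = C) (k13 : k / 2 ≤ g13 ∨ g13 = C) (k23 : k / 2 ≤ g23 ∨ g23 = C)
    (hg : g13 ^ 2 < k ^ 2) (hg12 : g12 ≤ k) (hab : 1 < a + b) (hm : ¬ (m1 = 0 ∧ m2 = 0)) :
    False := by
  have hm2 : m2 ≠ 0 := fun h => hm ⟨h1.trans h, h⟩
  have hm3 : w / 2 ≤ m3 := by
    rcases h3 with h | h
    · exact h
    · exfalso
      rw [h1, h] at em
      have : (a + b - 1) * m2 = 0 := by linarith
      rcases mul_eq_zero.1 this with h' | h'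
      · linarith
      · exact hm2 h'
  have hm2' : m2 < 0 := lt_of_le_of_ne h2 hm2
  have hbm : 0 < b * m3 := by apply mul_pos hb; linarith
  rw [h1] at em
  have ha1 : 1 < a := by
    by_contra! h
    nlinarith
  have hneg : g13 < 0 := by
    by_contra! h
    nlinarith [mul_nonneg hb.le h]
  have h13 : g13 = C := k13.resolve_left (by linarith)
  have h12 : k / 2 ≤ g12 := by
    refine k12.resolve_right fun h => ?_
    have hgg : g12 = g13 := h.trans h13.symm
    have hb2 : (b ^ 2 - 1) * (k ^ 2 - g13 ^ 2) = 0 := by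
      have n : k ^ 2 = a ^ 2 * k ^ 2 + 2 * a * b * g13 * k + b ^ 2 * k ^ 2 := by
        calc k ^ 2 = (a * g12 + b * g23) * k := by rw [← e2]; ring
          _ = _ := by rw [e12, e23]; ring
      have : g13 ^ 2 = (a * k + b * g13) ^ 2 := by rw [← e12, hgg]
      linear_combination this - n
    have hb1 : b = 1 := by
      rcases mul_eq_zero.1 hb2 with h' | h'
      · nlinarith
      · linarith
    rw [hb1, hgg] at e12
    nlinarith
  have h23 : k / 2 ≤ g23 := by
    refine k23.resolve_right fun h => ?_
    have hgg : g23 = g13 := h.trans h13.symm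
    have ha2 : (a ^ 2 - 1) * (k ^ 2 - g13 ^ 2) = 0 := by
      have n : k ^ 2 = a ^ 2 * k ^ 2 + 2 * a * b * g13 * k + b ^ 2 * k ^ 2 := by
        calc k ^ 2 = (a * g12 + b * g23) * k := by rw [← e2]; ring
          _ = _ := by rw [e12, e23]; ring
      have : g13 ^ 2 = (a * g13 + b * k) ^ 2 := by rw [← e23, hgg]
      linear_combination this - n
    rcases mul_eq_zero.1 ha2 with h' | h'
    · nlinarith
    · linarith
  -- The sine comparison in algebraic form: expand |b u₃|² = |u₂ − a u₁|² and bound b through k = S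
  -- + b g23.
  obtain ⟨S, hS⟩ : ∃ S, S = a * g12 := ⟨_, rfl⟩
  have hS1 : k < 2 * S := by rw [hS]; nlinarith
  have hS2 : b * (k / 2) ≤ k - S := by rw [hS]; nlinarith
  have hS3 : S < k := by nlinarith [mul_pos hb hk]
  have hnorm : b ^ 2 * k ^ 2 = k ^ 2 - 2 * S * k + a ^ 2 * k ^ 2 := by
    have : b * g13 = g12 - a * k := by linarith
    have e : k * k = a * g12 * k + a * k * (b * g13) + b ^ 2 * k ^ 2 := by
      calc k * k = (a * g12 + b * g23) * k := by rw [← e2]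
        _ = _ := by rw [e23]; ring
    rw [this] at e
    rw [hS]; linear_combination -e
  have hfour : b ^ 2 * k ^ 2 ≤ 4 * (k - S) ^ 2 := by
    have h0 : 0 ≤ b * (k / 2) := by positivity
    nlinarith
  have hfin : 0 < (k - S) * (2 * S - k) := mul_pos (by linarith) (by linarith)
  have hak : k ^ 2 < a ^ 2 * k ^ 2 := by
    have : 1 < a ^ 2 := by nlinarith
    have : 0 < k ^ 2 := by positivity
    nlinarith
  nlinarith

/-- Of three neighbours of `p`, one that has a point at the largest distance does not lie between
the two others. -/
theorem not_between_of_far {d D : ℝ} (hd : 0 < d) (hdD : d < D) {p u₁ u₂ u₃ v : Plane}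
    (h1 : dist p u₁ = d) (h2 : dist p u₂ = d) (h3 : dist p u₃ = d)
    (h12 : dist u₁ u₂ ≤ d ∨ dist u₁ u₂ = D) (h13 : dist u₁ u₃ ≤ d ∨ dist u₁ u₃ = D)
    (h23 : dist u₂ u₃ ≤ d ∨ dist u₂ u₃ = D) (hv2 : dist u₂ v = D)
    (hv1 : dist u₁ v ≤ d ∨ dist u₁ v = D) (hv3 : dist u₃ v ≤ d ∨ dist u₃ v = D)
    (c12 : 0 < cr p u₁ u₂ * cr p u₁ u₃) (c23 : 0 < cr p u₂ u₃ * cr p u₁ u₃) : False := by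
  have k1 := dist_sq_eq p u₁
  have k2 := dist_sq_eq p u₂
  have k3 := dist_sq_eq p u₃
  have k12 := dist_sq_eq u₁ u₂
  have k13 := dist_sq_eq u₁ u₃
  have k23 := dist_sq_eq u₂ u₃
  have l2 := dist_sq_eq u₂ v
  have l1 := dist_sq_eq u₁ v
  have l3 := dist_sq_eq u₃ v
  have sq_alt : ∀ {x y : Plane}, (dist x y ≤ d ∨ dist x y = D) →
      (dist x y ^ 2 ≤ d ^ 2 ∨ dist x y ^ 2 = D ^ 2) := by
    intro x y h
    rcases h with h | h
    · exact Or.inl (by gcongr)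
    · exact Or.inr (by rw [h])
  have s12 := sq_alt h12
  have s13 := sq_alt h13
  have s23 := sq_alt h23
  have t1 := sq_alt hv1
  have t3 := sq_alt hv3
  have hDd : d ^ 2 < D ^ 2 := by gcongr
  have hdd : 0 < d ^ 2 := by positivity
  rw [h1] at k1; rw [h2] at k2; rw [h3] at k3; rw [hv2] at l2
  rw [k12] at s12; rw [k13] at s13; rw [k23] at s23; rw [l1] at t1; rw [l3] at t3
  clear h1 h2 h3 h12 h13 h23 hv2 hv1 hv3 k12 k13 k23 l1 l3 sq_alt
  unfold cr at c12 c23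
  generalize hx1 : u₁ 0 - p 0 = x1 at *
  generalize hy1 : u₁ 1 - p 1 = y1 at *
  generalize hx2 : u₂ 0 - p 0 = x2 at *
  generalize hy2 : u₂ 1 - p 1 = y2 at *
  generalize hx3 : u₃ 0 - p 0 = x3 at *
  generalize hy3 : u₃ 1 - p 1 = y3 at *
  generalize hx : v 0 - p 0 = x at *
  generalize hy : v 1 - p 1 = y at *
  generalize hk : d ^ 2 = k at *
  generalize hK : D ^ 2 = K at *
  have K1 : x1 ^ 2 + y1 ^ 2 = k := by rw [← hx1, ← hy1, k1]; ring
  have K2 : x2 ^ 2 + y2 ^ 2 = k := by rw [← hx2, ← hy2, k2]; ring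
  have K3 : x3 ^ 2 + y3 ^ 2 = k := by rw [← hx3, ← hy3, k3]; ring
  have D12 : (u₁ 0 - u₂ 0) ^ 2 + (u₁ 1 - u₂ 1) ^ 2 = 2 * k - 2 * (x1 * x2 + y1 * y2) := by
    rw [two_mul k]; nth_rw 1 [← K1]; rw [← K2, ← hx1, ← hy1, ← hx2, ← hy2]; ring
  have D13 : (u₁ 0 - u₃ 0) ^ 2 + (u₁ 1 - u₃ 1) ^ 2 = 2 * k - 2 * (x1 * x3 + y1 * y3) := by
    rw [two_mul k]; nth_rw 1 [← K1]; rw [← K3, ← hx1, ← hy1, ← hx3, ← hy3]; ring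
  have D23 : (u₂ 0 - u₃ 0) ^ 2 + (u₂ 1 - u₃ 1) ^ 2 = 2 * k - 2 * (x2 * x3 + y2 * y3) := by
    rw [two_mul k]; nth_rw 1 [← K2]; rw [← K3, ← hx2, ← hy2, ← hx3, ← hy3]; ring
  have E1 : (u₁ 0 - v 0) ^ 2 + (u₁ 1 - v 1) ^ 2 =
      k + (x ^ 2 + y ^ 2) - 2 * (x * x1 + y * y1) := by
    rw [← K1, ← hx1, ← hy1, ← hx, ← hy]; ring
  have E2 : (u₂ 0 - v 0) ^ 2 + (u₂ 1 - v 1) ^ 2 =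
      k + (x ^ 2 + y ^ 2) - 2 * (x * x2 + y * y2) := by
    rw [← K2, ← hx2, ← hy2, ← hx, ← hy]; ring
  have E3 : (u₃ 0 - v 0) ^ 2 + (u₃ 1 - v 1) ^ 2 =
      k + (x ^ 2 + y ^ 2) - 2 * (x * x3 + y * y3) := by
    rw [← K3, ← hx3, ← hy3, ← hx, ← hy]; ring
  rw [D12] at s12; rw [D13] at s13; rw [D23] at s23
  rw [E1] at t1; rw [E2] at l2; rw [E3] at t3
  clear D12 D13 D23 E1 E2 E3 k1 k2 k3 hx1 hy1 hx2 hy2 hx3 hy3 hx hy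
  have hz : x1 * y3 - y1 * x3 ≠ 0 := by intro h; rw [h] at c12; simp at c12
  -- Cramer's rule for u₂ = a u₁ + b u₃; betweenness makes both coefficients positive.
  obtain ⟨a, hadef⟩ : ∃ a, a = (x2 * y3 - y2 * x3) / (x1 * y3 - y1 * x3) := ⟨_, rfl⟩
  obtain ⟨b, hbdef⟩ : ∃ b, b = (x1 * y2 - y1 * x2) / (x1 * y3 - y1 * x3) := ⟨_, rfl⟩
  have ha : 0 < a := by
    rw [hadef]
    have : (x2 * y3 - y2 * x3) / (x1 * y3 - y1 * x3) =
      (x2 * y3 - y2 * x3) * (x1 * y3 - y1 * x3) / (x1 * y3 - y1 * x3) ^ 2 := by field_simp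
    rw [this]; exact div_pos c23 (by positivity)
  have hb : 0 < b := by
    rw [hbdef]
    have : (x1 * y2 - y1 * x2) / (x1 * y3 - y1 * x3) =
      (x1 * y2 - y1 * x2) * (x1 * y3 - y1 * x3) / (x1 * y3 - y1 * x3) ^ 2 := by field_simp
    rw [this]; exact div_pos c12 (by positivity)
  have X2 : x2 = a * x1 + b * x3 := by
    rw [hadef, hbdef, div_mul_eq_mul_div, div_mul_eq_mul_div, ← add_div, eq_div_iff hz]; ring
  have Y2 : y2 = a * y1 + b * y3 := by
    rw [hadef, hbdef, div_mul_eq_mul_div, div_mul_eq_mul_div, ← add_div, eq_div_iff hz]; ring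
  have hdet12 : x1 * y2 - y1 * x2 ≠ 0 := by intro h; rw [h] at c12; simp at c12
  have hdet23 : x2 * y3 - y2 * x3 ≠ 0 := by intro h; rw [h] at c23; simp at c23
  have hg : (x1 * x3 + y1 * y3) ^ 2 < k ^ 2 := by
    have : (x1 * x3 + y1 * y3) ^ 2 + (x1 * y3 - y1 * x3) ^ 2 = k ^ 2 := by
      rw [sq k]; nth_rw 1 [← K1]; rw [← K3]; ring
    have := sq_pos_of_ne_zero hz
    linarith
  have hg12 : x1 * x2 + y1 * y2 ≤ k := by linarith [sq_nonneg (x1 - x2), sq_nonneg (y1 - y2)]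
  have hg23 : x2 * x3 + y2 * y3 ≤ k := by linarith [sq_nonneg (x2 - x3), sq_nonneg (y2 - y3)]
  have hg13 : x1 * x3 + y1 * y3 < k := lt_of_pow_lt_pow_left₀ 2 hdd.le hg
  have hw : 0 < x ^ 2 + y ^ 2 := by
    rcases (by positivity : 0 ≤ x ^ 2 + y ^ 2).eq_or_lt with h | h
    · exfalso
      have hx0 : x = 0 := by
        have : x ^ 2 = 0 := by linarith [sq_nonneg x, sq_nonneg y]
        exact pow_eq_zero_iff two_ne_zero |>.1 this
      have hy0 : y = 0 := by
        have : y ^ 2 = 0 := by linarith [sq_nonneg x, sq_nonneg y]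
        exact pow_eq_zero_iff two_ne_zero |>.1 this
      rw [hx0, hy0] at l2
      linarith
    · exact h
  have perp : ∀ {z w z' w' : ℝ}, z * w' - w * z' ≠ 0 →
      ¬ (x * z + y * w = 0 ∧ x * z' + y * w' = 0) := by
    rintro z w z' w' hne ⟨q1, q2⟩
    have hx0 : x * (z * w' - w * z') = 0 := by linear_combination w' * q1 - w * q2
    have hy0 : y * (z * w' - w * z') = 0 := by linear_combination z * q2 - z' * q1
    rw [(mul_eq_zero.1 hx0).resolve_right hne, (mul_eq_zero.1 hy0).resolve_right hne] at hw
    simp at hw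
  have e12 : x1 * x2 + y1 * y2 = a * k + b * (x1 * x3 + y1 * y3) := by rw [X2, Y2, ← K1]; ring
  have e23 : x2 * x3 + y2 * y3 = a * (x1 * x3 + y1 * y3) + b * k := by rw [X2, Y2, ← K3]; ring
  have e2 : k = a * (x1 * x2 + y1 * y2) + b * (x2 * x3 + y2 * y3) := by
    nth_rw 1 [← K2]
    calc x2 ^ 2 + y2 ^ 2 = x2 * (a * x1 + b * x3) + y2 * (a * y1 + b * y3) := by
          rw [← X2, ← Y2]; ring
      _ = _ := by ring
  have em : x * x2 + y * y2 = a * (x * x1 + y * y1) + b * (x * x3 + y * y3) := by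
    rw [X2, Y2]; ring
  have hab : 1 < a + b := by
    by_contra! h
    have n : k = a ^ 2 * k + 2 * a * b * (x1 * x3 + y1 * y3) + b ^ 2 * k := by
      nth_rw 1 [e2, e12, e23]; ring
    have : 2 * a * b * (x1 * x3 + y1 * y3) < 2 * a * b * k := by gcongr
    have h' : (a + b) ^ 2 ≤ 1 := pow_le_one₀ (by linarith) h
    have h'' := mul_nonneg (sub_nonneg.2 h') hdd.le
    linarith
  have t1' : (x ^ 2 + y ^ 2) / 2 ≤ x * x1 + y * y1 ∨ x * x1 + y * y1 = x * x2 + y * y2 := by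
    rcases t1 with h | h
    · left; linarith
    · right; linarith
  have t3' : (x ^ 2 + y ^ 2) / 2 ≤ x * x3 + y * y3 ∨ x * x3 + y * y3 = x * x2 + y * y2 := by
    rcases t3 with h | h
    · left; linarith
    · right; linarith
  have s12' : k / 2 ≤ x1 * x2 + y1 * y2 ∨ x1 * x2 + y1 * y2 = k - K / 2 := by
    rcases s12 with h | h
    · left; linarith
    · right; linarith
  have s13' : k / 2 ≤ x1 * x3 + y1 * y3 ∨ x1 * x3 + y1 * y3 = k - K / 2 := by
    rcases s13 with h | h
    · left; linarith
    · right; linarith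
  have s23' : k / 2 ≤ x2 * x3 + y2 * y3 ∨ x2 * x3 + y2 * y3 = k - K / 2 := by
    rcases s23 with h | h
    · left; linarith
    · right; linarith
  have hm2w : x * x2 + y * y2 < (x ^ 2 + y ^ 2) / 2 := by linarith
  -- No uᵢ is farther from v than u₂, so the other products are at least this one; as a + b > 1, it
  -- cannot be positive.
  have hm2 : x * x2 + y * y2 ≤ 0 := by
    by_contra! h
    have q1 : x * x2 + y * y2 ≤ x * x1 + y * y1 := by rcases t1' with h | h <;> linarith
    have q3 : x * x2 + y * y2 ≤ x * x3 + y * y3 := by rcases t3' with h | h <;> linarith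
    have r1 := mul_le_mul_of_nonneg_left q1 ha.le
    have r3 := mul_le_mul_of_nonneg_left q3 hb.le
    have r4 : 0 < (a + b - 1) * (x * x2 + y * y2) := mul_pos (by linarith) h
    linarith
  rcases t1' with h | h
  · rcases t3' with h' | h'
    · have r1 : 0 < a * (x * x1 + y * y1) := by apply mul_pos ha; linarith
      have r3 : 0 < b * (x * x3 + y * y3) := by apply mul_pos hb; linarith
      linarith
    · exact no_middle_scalar (k := k) (C := k - K / 2) (a := b) (b := a)
        (g12 := x2 * x3 + y2 * y3) (g13 := x1 * x3 + y1 * y3) (g23 := x1 * x2 + y1 * y2)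
        (m1 := x * x3 + y * y3) (m2 := x * x2 + y * y2) (m3 := x * x1 + y * y1) (w := x ^ 2 + y ^ 2)
        hdd hb ha (by linarith) (by linarith) (by linarith) (by linarith) hw
        h' hm2 (Or.inl h) s23' s13' s12' hg hg23 (by linarith)
        (fun q => perp hdet23 ⟨q.2, q.1⟩)
  · exact no_middle_scalar (k := k) (C := k - K / 2) (a := a) (b := b)
      (g12 := x1 * x2 + y1 * y2) (g13 := x1 * x3 + y1 * y3) (g23 := x2 * x3 + y2 * y3)
      (m1 := x * x1 + y * y1) (m2 := x * x2 + y * y2) (m3 := x * x3 + y * y3) (w := x ^ 2 + y ^ 2)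
      hdd ha hb e12 e23 e2 em hw h hm2 t3' s12' s13' s23' hg hg12 hab
      (perp hdet12)

/-! ### Counting edges with an abstract left–right order. -/

open Classical in
/-- The ordered pairs of adjacent vertices. -/
noncomputable def darts {α : Type*} (V : Finset α) (adj : α → α → Prop) : Finset (α × α) :=
  (V ×ˢ V).filter fun e => adj e.1 e.2

open Classical in
/-- The darts that are rightmost at neither end. -/
noncomputable def zigDarts {α : Type*} (V : Finset α) (adj : α → α → Prop)
    (rt : α → α → α → Prop) : Finset (α × α) :=
  (darts V adj).filter fun e =>
    (∃ a, adj e.1 a ∧ rt e.1 e.2 a) ∧ ∃ b, adj e.2 b ∧ rt e.2 e.1 b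

/-- `rt q r a` (`a` is to the right of `r` at `q`) linearly orders the neighbours of each vertex,
and an edge that is rightmost at neither end is second from the right at both. -/
structure RightOrder {α : Type*} (V : Finset α) (adj : α → α → Prop)
    (rt : α → α → α → Prop) : Prop where
  mem : ∀ {q r}, adj q r → q ∈ V
  symm : ∀ {q r}, adj q r → adj r q
  total : ∀ {q r a}, adj q r → adj q a → r ≠ a → rt q r a ∨ rt q a r
  asymm : ∀ {q r a}, rt q r a → ¬ rt q a r
  trans : ∀ {q r a c}, adj q r → adj q a → adj q c → rt q r a → rt q a c → rt q r c
  unique : ∀ {q r a a' b}, adj q r → adj q a → adj q a' → adj r b → rt q r a → rt q r a' →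
    rt r q b → a = a'

section

variable {α : Type*} {V : Finset α} {adj : α → α → Prop} {rt : α → α → α → Prop}

theorem mem_darts (h : RightOrder V adj rt) {e : α × α} : e ∈ darts V adj ↔ adj e.1 e.2 := by
  simp only [darts, Finset.mem_filter, Finset.mem_product, and_iff_right_iff_imp]
  exact fun he => ⟨h.mem he, h.mem (h.symm he)⟩

theorem mem_zigDarts (h : RightOrder V adj rt) {e : α × α} : e ∈ zigDarts V adj rt ↔
    adj e.1 e.2 ∧ (∃ a, adj e.1 a ∧ rt e.1 e.2 a) ∧ ∃ b, adj e.2 b ∧ rt e.2 e.1 b := by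
  simp only [zigDarts, Finset.mem_filter, mem_darts h]

/-- Of two zigs at `q`, the left one would have two neighbours to its right: the other zig and
whatever lies beyond that. -/
theorem RightOrder.zig_eq (h : RightOrder V adj rt) {q r r' : α}
    (h1 : (q, r) ∈ zigDarts V adj rt) (h2 : (q, r') ∈ zigDarts V adj rt) : r = r' := by
  have aux : ∀ {r r' : α}, (q, r) ∈ zigDarts V adj rt → (q, r') ∈ zigDarts V adj rt →
      ¬ rt q r r' := by
    intro r r' h1 h2 hrt
    obtain ⟨hr, ⟨a, ha, hra⟩, b, hb, hrb⟩ := (mem_zigDarts h).1 h1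
    obtain ⟨hr', ⟨a', ha', hra'⟩, -⟩ := (mem_zigDarts h).1 h2
    have := h.unique hr hr' ha' hb hrt (h.trans hr hr' ha' hrt hra') hrb
    rw [← this] at hra'
    exact h.asymm hra' hra'
  by_contra hne
  rcases h.total ((mem_zigDarts h).1 h1).1 ((mem_zigDarts h).1 h2).1 hne with h' | h'
  · exact aux h1 h2 h'
  · exact aux h2 h1 h'

theorem RightOrder.zig_swap (h : RightOrder V adj rt) {e : α × α}
    (he : e ∈ zigDarts V adj rt) : e.swap ∈ zigDarts V adj rt := by
  rw [mem_zigDarts h] at he ⊢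
  exact ⟨h.symm he.1, he.2.2, he.2.1⟩

/-- If a symmetric family of darts is covered by darts from a part and their reversals, and the
darts of the part are determined by an injection, then it has at most twice as many elements as
the target. -/
theorem card_le_two_mul_of_swap {β : Type*} {Z H : Finset (α × α)} {W : Finset β}
    (hZ : ∀ e ∈ Z, e ∈ H ∨ e.swap ∈ H) (f : α × α → β) (hf : ∀ e ∈ H, f e ∈ W)
    (hinj : Set.InjOn f H) : Z.card ≤ 2 * W.card := by
  classical
  have h1 : Z ⊆ H ∪ H.image Prod.swap := by
    intro e he
    rcases hZ e he with h | h
    · exact Finset.mem_union_left _ h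
    · exact Finset.mem_union_right _ (Finset.mem_image.2 ⟨_, h, Prod.swap_swap e⟩)
  have h2 : H.card ≤ W.card := Finset.card_le_card_of_injOn f hf hinj
  calc Z.card ≤ (H ∪ H.image Prod.swap).card := Finset.card_le_card h1
    _ ≤ H.card + (H.image Prod.swap).card := Finset.card_union_le _ _
    _ ≤ H.card + H.card := Nat.add_le_add_left Finset.card_image_le _
    _ ≤ 2 * W.card := by omega

/-- A non-zig edge is rightmost at an end, and each vertex has at most one rightmost edge; every
edge is two darts. -/
theorem RightOrder.card_darts_le (h : RightOrder V adj rt) :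
    (darts V adj).card ≤ 2 * V.card + (zigDarts V adj rt).card := by
  classical
  set N : Finset (α × α) := darts V adj \ zigDarts V adj rt with hN
  have hc : (darts V adj).card = N.card + (zigDarts V adj rt).card := by
    have hsub : zigDarts V adj rt ⊆ darts V adj := Finset.filter_subset _ _
    exact (Finset.card_sdiff_add_card_eq_card hsub).symm
  rw [hc]
  gcongr
  refine card_le_two_mul_of_swap
    (H := (darts V adj).filter fun e => ¬ ∃ a, adj e.1 a ∧ rt e.1 e.2 a) ?_ Prod.fst ?_ ?_
  · intro e he
    rw [hN, Finset.mem_sdiff, mem_darts h, mem_zigDarts h] at he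
    simp only [Finset.mem_filter, mem_darts h, Prod.fst_swap, Prod.snd_swap]
    by_cases h1 : ∃ a, adj e.1 a ∧ rt e.1 e.2 a
    · exact Or.inr ⟨h.symm he.1, fun h2 => he.2 ⟨he.1, h1, h2⟩⟩
    · exact Or.inl ⟨he.1, h1⟩
  · intro e he
    exact h.mem ((mem_darts h).1 (Finset.mem_filter.1 he).1)
  · rintro ⟨q, r⟩ he ⟨q', r'⟩ he' (rfl : q = q')
    simp only [Finset.coe_filter, Set.mem_ofPred_eq, mem_darts h] at he he'
    congr 1
    by_contra hne
    rcases h.total he.1 he'.1 hne with h' | h'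
    · exact he.2 ⟨r', he'.1, h'⟩
    · exact he'.2 ⟨r, he.1, h'⟩

theorem RightOrder.card_zigDarts_le (h : RightOrder V adj rt) :
    (zigDarts V adj rt).card ≤ V.card := by
  refine Finset.card_le_card_of_injOn Prod.fst (fun e he => h.mem ((mem_zigDarts h).1 he).1) ?_
  rintro ⟨q, r⟩ he ⟨q', r'⟩ he' (rfl : q = q')
  rw [h.zig_eq he he']

theorem RightOrder.card_zigDarts_le_of_cover (h : RightOrder V adj rt) {U : Finset α}
    (hU : ∀ {q r}, adj q r → q ∈ U ∨ r ∈ U) : (zigDarts V adj rt).card ≤ 2 * U.card := by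
  classical
  refine card_le_two_mul_of_swap (H := (zigDarts V adj rt).filter fun e => e.1 ∈ U) ?_ Prod.fst
    (fun e he => (Finset.mem_filter.1 he).2) ?_
  · intro e he
    simp only [Finset.mem_filter]
    rcases hU ((mem_zigDarts h).1 he).1 with h' | h'
    · exact Or.inl ⟨he, h'⟩
    · exact Or.inr ⟨h.zig_swap he, h'⟩
  · rintro ⟨q, r⟩ he ⟨q', r'⟩ he' (rfl : q = q')
    rw [h.zig_eq (Finset.mem_filter.1 he).1 (Finset.mem_filter.1 he').1]

/-- The right neighbour `a` of one end of an edge is not an end of an edge of the opposite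
orientation that is rightmost at neither end. -/
def FreeEnd (adj : α → α → Prop) (rt : α → α → α → Prop) (q a : α) : Prop :=
  (∀ x, adj a x → ¬ rt a x q) ∧ ∀ p l, adj a p → rt a q p → adj p l → ¬ rt p l a

/-- `Y` is the set of vertices on left zigs, one zig per vertex. Each right zig has a free end
outside `Y`, and that end determines the zig: `q` is the leftmost neighbour of `a`, and `q` is on
only one right zig. -/
theorem RightOrder.card_zigDarts_add_le (h : RightOrder V adj rt)
    (h' : RightOrder V adj fun q r a => rt q a r)
    (hfree : ∀ {q r a b}, adj q r → adj q a → adj r b → rt q r a → rt r q b →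
      FreeEnd adj rt q a ∨ FreeEnd adj rt r b) :
    (zigDarts V adj rt).card + 2 * (zigDarts V adj fun q r a => rt q a r).card ≤ 2 * V.card := by
  classical
  set Y := (zigDarts V adj fun q r a => rt q a r).image Prod.fst with hY
  have hYc : Y.card = (zigDarts V adj fun q r a => rt q a r).card := by
    refine Finset.card_image_of_injOn ?_
    rintro ⟨q, r⟩ he ⟨q', r'⟩ he' (rfl : q = q')
    rw [h'.zig_eq he he']
  have hYV : Y ⊆ V := by
    intro q hq
    obtain ⟨e, he, rfl⟩ := Finset.mem_image.1 hq
    exact h'.mem ((mem_zigDarts h').1 he).1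
  have hcard := Finset.card_sdiff_add_card_eq_card hYV
  rcases V.eq_empty_or_nonempty with hV | ⟨v0, -⟩
  · have := h.card_zigDarts_le
    have := h'.card_zigDarts_le
    have hV' : V.card = 0 := by rw [hV, Finset.card_empty]
    omega
  -- `v0` only serves as a value off the zigs.
  have hex : ∀ e : α × α, ∃ a, e ∈ zigDarts V adj rt → adj e.1 a ∧ rt e.1 e.2 a := by
    intro e
    by_cases he : e ∈ zigDarts V adj rt
    · obtain ⟨a, ha⟩ := ((mem_zigDarts h).1 he).2.1
      exact ⟨a, fun _ => ha⟩
    · exact ⟨v0, fun h => absurd h he⟩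
  choose f hf using hex
  have key : (zigDarts V adj rt).card ≤ 2 * (V \ Y).card := by
    refine card_le_two_mul_of_swap
      (H := (zigDarts V adj rt).filter fun e => FreeEnd adj rt e.1 (f e)) ?_ f ?_ ?_
    · intro e he
      have he' := h.zig_swap he
      simp only [Finset.mem_filter]
      obtain ⟨h1, h2⟩ := hf e he
      obtain ⟨h3, h4⟩ := hf _ he'
      rcases hfree ((mem_zigDarts h).1 he).1 h1 h3 h2 h4 with h5 | h5
      · exact Or.inl ⟨he, h5⟩
      · exact Or.inr ⟨he', h5⟩
    · intro e he
      obtain ⟨he, hfr⟩ := Finset.mem_filter.1 he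
      obtain ⟨h1, h2⟩ := hf e he
      rw [Finset.mem_sdiff]
      refine ⟨h.mem (h.symm h1), fun hYe => ?_⟩
      obtain ⟨⟨a, p⟩, hap, hae⟩ := Finset.mem_image.1 hYe
      obtain ⟨g1, ⟨x, gx, gx'⟩, l, gl, gl'⟩ := (mem_zigDarts h').1 hap
      simp only at hae g1 gx gx' gl gl'
      subst hae
      have hpe : e.1 ≠ p := by
        rintro rfl
        exact hfr.1 x gx gx'
      rcases h.total (h.symm h1) g1 hpe with h5 | h5
      · exact hfr.2 p l g1 h5 gl gl'
      · exact hfr.1 p g1 h5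
    · intro e he e' he' hee
      obtain ⟨he, hfr⟩ := Finset.mem_filter.1 he
      obtain ⟨he', hfr'⟩ := Finset.mem_filter.1 he'
      obtain ⟨h1, -⟩ := hf e he
      obtain ⟨h1', -⟩ := hf e' he'
      rw [← hee] at h1' hfr'
      have hq : e.1 = e'.1 := by
        by_contra hne
        rcases h.total (h.symm h1) (h.symm h1') hne with h5 | h5
        · exact hfr'.1 _ (h.symm h1) h5
        · exact hfr.1 _ (h.symm h1') h5
      obtain ⟨q, r⟩ := e
      obtain ⟨q', r'⟩ := e'
      simp only at hq
      subst hq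
      rw [h.zig_eq he he']
  omega

/-- The bound for points in convex position. -/
theorem RightOrder.three_mul_card_darts_le (h : RightOrder V adj rt)
    (h' : RightOrder V adj fun q r a => rt q a r)
    (hfree : ∀ {q r a b}, adj q r → adj q a → adj r b → rt q r a → rt r q b →
      FreeEnd adj rt q a ∨ FreeEnd adj rt r b)
    (hfree' : ∀ {q r a b}, adj q r → adj q a → adj r b → rt q a r → rt r b q →
      FreeEnd adj (fun q r a => rt q a r) q a ∨ FreeEnd adj (fun q r a => rt q a r) r b) :
    3 * (darts V adj).card ≤ 8 * V.card := by
  have h1 := h.card_zigDarts_add_le h' hfree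
  have h2 := h'.card_zigDarts_add_le h hfree'
  have h3 := h.card_darts_le
  have h4 := h'.card_darts_le
  -- Adding `h1` and `h2`, one orientation has at most 2|V|/3 zig darts; use `h3` or `h4` for that
  -- one.
  omega

end

/-! ### The distance graph satisfies the order axioms. -/

/-- Adjacency at distance `d` within `V`. -/
def DistAdj (V : Finset Plane) (d : ℝ) (q r : Plane) : Prop :=
  q ∈ V ∧ r ∈ V ∧ dist q r = d

theorem DistAdj.symm {V : Finset Plane} {d : ℝ} {q r : Plane} (h : DistAdj V d q r) :
    DistAdj V d r q :=
  ⟨h.2.1, h.1, by rw [dist_comm]; exact h.2.2⟩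

theorem rightOf_flip {s : ℝ} {q r a : Plane} : RightOf (-s) q r a ↔ RightOf s q a r := by
  unfold RightOf
  rw [cr_swap q r a]
  constructor <;> intro h <;> linarith

theorem rightOf_flip_eq (s : ℝ) : (fun q r a => RightOf s q a r) = RightOf (-s) := by
  funext q r a
  exact propext rightOf_flip.symm

theorem dist_eq_of_zigzag {V : Finset Plane} {s d D : ℝ} (hd : 0 < d) (hs : s * s = 1)
    (hV : ∀ x ∈ V, ∀ y ∈ V, dist x y ≤ d ∨ dist x y = D) {q r a b : Plane}
    (hqr : DistAdj V d q r) (hqa : DistAdj V d q a) (hrb : DistAdj V d r b)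
    (ha : RightOf s q r a) (hb : RightOf s r q b) : dist a b = D :=
  (hV a hqa.2.1 b hrb.2.1).resolve_left
    (not_le.2 (zigzag_dist hd hs hqr.2.2 hqa.2.2 hrb.2.2 ha hb))

/-- The alternative in `hloc` serves the second layer, where convex independence in `V` fails in
general but degree at most 2 makes transitivity and uniqueness trivial. -/
theorem rightOrder_distAdj {V : Finset Plane} {s d D : ℝ} (hd : 0 < d) (hs : s * s = 1)
    (hV : ∀ x ∈ V, ∀ y ∈ V, dist x y ≤ d ∨ dist x y = D)
    (hloc : ∀ q ∈ V, ConvexIndepAt V q ∨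
      ((∀ r a, DistAdj V d q r → DistAdj V d q a → r ≠ a → cr q r a ≠ 0) ∧
        ∀ r a c, DistAdj V d q r → DistAdj V d q a → DistAdj V d q c → r = a ∨ a = c ∨ r = c)) :
    RightOrder V (DistAdj V d) (RightOf s) where
  mem h := h.1
  symm h := h.symm
  total := by
    intro q r a hr ha hne
    have hs0 : s ≠ 0 := by rintro rfl; simp at hs
    have hc : cr q r a ≠ 0 := by
      rcases hloc q hr.1 with h | h
      · exact h.cr_ne_zero hr.2.1 ha.2.1 hd hr.2.2 ha.2.2 hne
      · exact h.1 r a hr ha hne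
    rcases lt_or_gt_of_ne (mul_ne_zero hs0 hc) with h | h
    · exact Or.inl h
    · right
      unfold RightOf
      rw [cr_swap]
      linarith
  asymm := by
    intro q r a h h'
    unfold RightOf at h h'
    rw [cr_swap] at h'
    linarith
  trans := by
    intro q r a c hr ha hc h1 h2
    unfold RightOf at h1 h2 ⊢
    rcases hloc q hr.1 with h | h
    · by_contra! h3
      refine h.not_cyclic (s := s) ha.2.1 hr.2.1 hc.2.1 (ne_of_dist_eq hd ha.2.2).symm
        (ne_of_dist_eq hd hr.2.2).symm (ne_of_dist_eq hd hc.2.2).symm ?_ h3 ?_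
      · rw [cr_swap]; linarith
      · rw [cr_swap]; linarith
    · rcases h.2 r a c hr ha hc with rfl | rfl | rfl
      · simp [cr] at h1; exfalso; nlinarith
      · exact h1
      · rw [cr_swap] at h2; linarith
  unique := by
    intro q r a a' b hr ha ha' hb h1 h2 h3
    have hne : ∀ {c}, RightOf s q r c → r ≠ c := by
      rintro c hc rfl
      simp [RightOf, cr_self] at hc
    rcases hloc q hr.1 with h | h
    · refine right_unique hd h hr.2.1 ha.2.1 ha'.2.1 hb.2.1 hr.2.2 ha.2.2 ha'.2.2 h1 h2 h3 ?_
      rw [dist_comm b, dist_comm b, dist_eq_of_zigzag hd hs hV hr ha hb h1 h3,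
        dist_eq_of_zigzag hd hs hV hr ha' hb h2 h3]
    · rcases h.2 r a a' hr ha ha' with h' | h' | h'
      · exact absurd h' (hne h1)
      · exact h'
      · exact absurd h' (hne h2)

/-- Either obstruction to freeness of `a` forces `dist a r < dist q b`; those at `b` force the
reverse, so they never occur together. -/
theorem freeEnd_of_le {V : Finset Plane} {s d D : ℝ} (hd : 0 < d) (hdD : d < D) (hs : s * s = 1)
    (hV : ∀ x ∈ V, ∀ y ∈ V, dist x y ≤ d ∨ dist x y = D) (hI : ∀ q ∈ V, ConvexIndepAt V q)
    {q r a b : Plane} (hqr : DistAdj V d q r) (hqa : DistAdj V d q a) (hrb : DistAdj V d r b)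
    (ha : RightOf s q r a) (hb : RightOf s r q b) (hle : dist q b ≤ dist a r) :
    FreeEnd (DistAdj V d) (RightOf s) q a := by
  have hab := dist_eq_of_zigzag hd hs hV hqr hqa hrb ha hb
  have hVD : ∀ x ∈ V, ∀ y ∈ V, dist x y ≤ D := by
    intro x hx y hy
    rcases hV x hx y hy with h | h <;> linarith
  constructor
  · intro x hax hx
    have hrx : dist r x = D := dist_eq_of_zigzag (s := -s) hd (by linarith) hV hqa hqr hax
      (rightOf_flip.2 ha) (rightOf_flip.2 hx)
    exact (dist_lt_of_left (V := (V : Set Plane)) hs hd hdD hI hqr.1 hqr.2.1 hqa.2.1 hrb.2.1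
      hax.2.1 hqr.2.2 hqa.2.2 hrb.2.2 hax.2.2 hab hrx ha hb hx).not_ge hle
  · intro p l hap hp hpl hl
    exact (dist_lt_of_second_left (V := (V : Set Plane)) hs hd hdD hI hVD hqr.1 hqa.2.1 hrb.2.1
      hap.2.1 hpl.2.1 hqr.2.2 hqa.2.2 hrb.2.2 hap.2.2 hpl.2.2 hab ha hb hp hl).not_ge hle

theorem freeEnd_or_freeEnd {V : Finset Plane} {s d D : ℝ} (hd : 0 < d) (hdD : d < D)
    (hs : s * s = 1) (hV : ∀ x ∈ V, ∀ y ∈ V, dist x y ≤ d ∨ dist x y = D)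
    (hI : ∀ q ∈ V, ConvexIndepAt V q)
    {q r a b : Plane} (hqr : DistAdj V d q r) (hqa : DistAdj V d q a) (hrb : DistAdj V d r b)
    (ha : RightOf s q r a) (hb : RightOf s r q b) :
    FreeEnd (DistAdj V d) (RightOf s) q a ∨ FreeEnd (DistAdj V d) (RightOf s) r b := by
  rcases le_total (dist q b) (dist a r) with h | h
  · exact Or.inl (freeEnd_of_le hd hdD hs hV hI hqr hqa hrb ha hb h)
  · exact Or.inr (freeEnd_of_le hd hdD hs hV hI hqr.symm hrb hqa hb ha
      (by rw [dist_comm r a, dist_comm b q]; exact h))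

/-- In convex position, the second largest distance occurs at most `4 n / 3` times. -/
theorem card_darts_le_of_convexIndep {V : Finset Plane} {d D : ℝ} (hd : 0 < d) (hdD : d < D)
    (hV : ∀ x ∈ V, ∀ y ∈ V, dist x y ≤ d ∨ dist x y = D) (hI : ∀ q ∈ V, ConvexIndepAt V q) :
    3 * (darts V (DistAdj V d)).card ≤ 8 * V.card := by
  have h1 : RightOrder V (DistAdj V d) (RightOf 1) :=
    rightOrder_distAdj hd (by norm_num) hV fun q hq => Or.inl (hI q hq)
  have h2 : RightOrder V (DistAdj V d) (RightOf (-1)) :=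
    rightOrder_distAdj hd (by norm_num) hV fun q hq => Or.inl (hI q hq)
  rw [← rightOf_flip_eq] at h2
  refine h1.three_mul_card_darts_le h2 (freeEnd_or_freeEnd hd hdD (by norm_num) hV hI) ?_
  rw [rightOf_flip_eq]
  intro q r a b hqr hqa hrb ha hb
  exact freeEnd_or_freeEnd hd hdD (by norm_num) hV hI hqr hqa hrb (rightOf_flip.2 ha)
    (rightOf_flip.2 hb)

/-! ### Convex layers and the degrees of inner points. -/

theorem firstLayer_subset (Y : Set Plane) : firstLayer Y ⊆ Y :=
  extremePoints_convexHull_subset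

theorem convexIndepAt_of_mem_firstLayer {Y : Set Plane} {q : Plane} (hq : q ∈ firstLayer Y) :
    ConvexIndepAt Y q := by
  have h := ((convex_convexHull ℝ Y).mem_extremePoints_iff_mem_sdiff_convexHull_sdiff.1 hq).2
  exact fun hq' => h (convexHull_mono (Set.sdiff_subset_sdiff_left (subset_convexHull ℝ Y)) hq')

/-- From any point, a non-extreme point of a set is not the farthest point of the set. -/
theorem exists_dist_lt_of_notMem_firstLayer {Y : Set Plane} {p : Plane} (hp : p ∈ Y)
    (hne : p ∉ firstLayer Y) (q : Plane) : ∃ y ∈ Y, dist p q < dist y q := by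
  unfold firstLayer at hne
  rw [mem_extremePoints_iff_left] at hne
  push Not at hne
  obtain ⟨x₁, h₁, x₂, h₂, hseg, hx⟩ := hne (subset_convexHull ℝ Y hp)
  have hS : Sbtw ℝ x₁ p x₂ := by
    rw [sbtw_iff_mem_image_Ioo_and_ne]
    refine ⟨by rwa [openSegment_eq_image_lineMap] at hseg, ?_⟩
    rintro rfl
    rw [openSegment_same] at hseg
    exact hx hseg.symm
  rcases lt_max_iff.1 (hS.dist_lt_max_dist q) with h | h
  · obtain ⟨y, hy, hyd⟩ := convexHull_exists_dist_ge h₁ q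
    exact ⟨y, hy, h.trans_le hyd⟩
  · obtain ⟨y, hy, hyd⟩ := convexHull_exists_dist_ge h₂ q
    exact ⟨y, hy, h.trans_le hyd⟩

theorem firstLayer_nonempty {Y : Set Plane} (hf : Y.Finite) (hne : Y.Nonempty) :
    (firstLayer Y).Nonempty := by
  have hc : IsCompact (convexHull ℝ Y) := hf.isCompact_convexHull ℝ
  exact hc.extremePoints_nonempty (convexHull_nonempty_iff.2 hne)

section

variable {X : Finset Plane} {d D : ℝ}

theorem mem_firstLayer_of_dist_eq (hdD : d < D)
    (hX : ∀ x ∈ X, ∀ y ∈ X, dist x y ≤ d ∨ dist x y = D) {x y : Plane} (hx : x ∈ X) (hy : y ∈ X)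
    (h : dist x y = D) : x ∈ firstLayer (X : Set Plane) := by
  by_contra hne
  obtain ⟨z, hz, hzy⟩ := exists_dist_lt_of_notMem_firstLayer (Finset.mem_coe.2 hx) hne y
  rcases hX z hz y hy with h' | h' <;> linarith

/-- A non-extreme `x` is beaten by a point farther from `y`, necessarily at distance D, so `y` is in
the first layer. If `x` were not extreme among the inner points, an inner point would be at distance
D from `y`. -/
theorem layers_of_dist_eq (hdD : d < D)
    (hX : ∀ x ∈ X, ∀ y ∈ X, dist x y ≤ d ∨ dist x y = D) {x y : Plane} (hx : x ∈ X) (hy : y ∈ X)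
    (h : dist x y = d) (hxL : x ∉ firstLayer (X : Set Plane)) :
    x ∈ secondLayer (X : Set Plane) ∧ y ∈ firstLayer (X : Set Plane) := by
  constructor
  · by_contra hne
    obtain ⟨z, hz, hzy⟩ := exists_dist_lt_of_notMem_firstLayer
      (show x ∈ (X : Set Plane) \ firstLayer X from ⟨hx, hxL⟩) hne y
    refine hz.2 (mem_firstLayer_of_dist_eq hdD hX hz.1 hy
      ((hX z hz.1 y hy).resolve_left (by linarith)))
  · obtain ⟨z, hz, hzy⟩ := exists_dist_lt_of_notMem_firstLayer (Finset.mem_coe.2 hx) hxL y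
    refine mem_firstLayer_of_dist_eq hdD hX hy hz ?_
    rw [dist_comm]
    exact (hX z hz y hy).resolve_left (by linarith)

/-- The neighbours of an inner point lie in an open half-plane, as soon as there is another
inner point. -/
theorem inner_pos_of_inner_points (hdD : d < D)
    (hX : ∀ x ∈ X, ∀ y ∈ X, dist x y ≤ d ∨ dist x y = D) {p z u : Plane} (hz : z ∈ X)
    (hzL : z ∉ firstLayer (X : Set Plane)) (hpz : p ≠ z) (hu : DistAdj X d p u) :
    0 < (u 0 - p 0) * (z 0 - p 0) + (u 1 - p 1) * (z 1 - p 1) := by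
  by_contra! h
  refine hzL (mem_firstLayer_of_dist_eq hdD hX hz hu.2.1 ((hX z hz u hu.2.1).resolve_left ?_))
  rw [not_le]
  have e1 := dist_sq_eq z u
  have e2 := dist_sq_eq p u
  have e3 := dist_sq_eq p z
  have hpos : 0 < dist p z ^ 2 := by have := dist_pos.2 hpz; positivity
  rw [hu.2.2] at e2
  refine lt_of_pow_lt_pow_left₀ 2 dist_nonneg ?_
  have : dist z u ^ 2 = dist p z ^ 2 + d ^ 2 -
      2 * ((u 0 - p 0) * (z 0 - p 0) + (u 1 - p 1) * (z 1 - p 1)) := by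
    rw [e1, e2, e3]; ring
  linarith

theorem cr_ne_zero_of_inner_points (hdD : d < D)
    (hX : ∀ x ∈ X, ∀ y ∈ X, dist x y ≤ d ∨ dist x y = D) {p z u v : Plane} (hz : z ∈ X)
    (hzL : z ∉ firstLayer (X : Set Plane)) (hpz : p ≠ z) (hu : DistAdj X d p u)
    (hv : DistAdj X d p v) (huv : u ≠ v) : cr p u v ≠ 0 := by
  intro h0
  have h1 := inner_pos_of_inner_points hdD hX hz hzL hpz hu
  have h2 := inner_pos_of_inner_points hdD hX hz hzL hpz hv
  rcases eq_or_opposite_of_cr_eq_zero (hu.2.2.trans hv.2.2.symm) h0 with h | ⟨h, h'⟩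
  · exact huv h
  · have : (u 0 - p 0) * (z 0 - p 0) + (u 1 - p 1) * (z 1 - p 1) +
        ((v 0 - p 0) * (z 0 - p 0) + (v 1 - p 1) * (z 1 - p 1)) = 0 := by
      linear_combination (z 0 - p 0) * h + (z 1 - p 1) * h'
    linarith

/-- The neighbours lie in an open half-plane at `p`, so one of three is between the others. As `p`
is not extreme, that one has a point at distance D, against `not_between_of_far`. -/
theorem no_three_neighbors_of_inner_points (hd : 0 < d) (hdD : d < D)
    (hX : ∀ x ∈ X, ∀ y ∈ X, dist x y ≤ d ∨ dist x y = D) {p z u₁ u₂ u₃ : Plane}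
    (hp : p ∈ X) (hpL : p ∉ firstLayer (X : Set Plane)) (hz : z ∈ X)
    (hzL : z ∉ firstLayer (X : Set Plane)) (hpz : p ≠ z) (h1 : DistAdj X d p u₁)
    (h2 : DistAdj X d p u₂) (h3 : DistAdj X d p u₃) (n12 : u₁ ≠ u₂) (n23 : u₂ ≠ u₃)
    (n13 : u₁ ≠ u₃) : False := by
  have btw : ∀ {a b c : Plane}, DistAdj X d p a → DistAdj X d p b → DistAdj X d p c →
      0 < cr p a b * cr p a c → 0 < cr p b c * cr p a c → False := by
    intro a b c ha hb hc hab hbc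
    obtain ⟨v, hv, hvb⟩ := exists_dist_lt_of_notMem_firstLayer (Finset.mem_coe.2 hp) hpL b
    rw [hb.2.2, dist_comm] at hvb
    exact not_between_of_far hd hdD ha.2.2 hb.2.2 hc.2.2 (hX a ha.2.1 b hb.2.1)
      (hX a ha.2.1 c hc.2.1) (hX b hb.2.1 c hc.2.1)
      ((hX b hb.2.1 v hv).resolve_left (not_le.2 hvb)) (hX a ha.2.1 v hv) (hX c hc.2.1 v hv)
      hab hbc
  have i1 := inner_pos_of_inner_points hdD hX hz hzL hpz h1
  have i2 := inner_pos_of_inner_points hdD hX hz hzL hpz h2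
  have i3 := inner_pos_of_inner_points hdD hX hz hzL hpz h3
  -- The linear relation among three plane vectors, paired with z − p. It excludes the two sign
  -- patterns in which no neighbour is in the middle.
  have cyc : cr p u₂ u₃ * ((u₁ 0 - p 0) * (z 0 - p 0) + (u₁ 1 - p 1) * (z 1 - p 1)) -
      cr p u₁ u₃ * ((u₂ 0 - p 0) * (z 0 - p 0) + (u₂ 1 - p 1) * (z 1 - p 1)) +
      cr p u₁ u₂ * ((u₃ 0 - p 0) * (z 0 - p 0) + (u₃ 1 - p 1) * (z 1 - p 1)) = 0 := by
    unfold cr; ring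
  have s21 : cr p u₂ u₁ = -cr p u₁ u₂ := cr_swap _ _ _
  have s32 : cr p u₃ u₂ = -cr p u₂ u₃ := cr_swap _ _ _
  have c12 := cr_ne_zero_of_inner_points hdD hX hz hzL hpz h1 h2 n12
  have c23 := cr_ne_zero_of_inner_points hdD hX hz hzL hpz h2 h3 n23
  have c13 := cr_ne_zero_of_inner_points hdD hX hz hzL hpz h1 h3 n13
  have m1 := btw h2 h1 h3
  have m2 := btw h1 h2 h3
  have m3 := btw h1 h3 h2
  rw [s21] at m1
  rw [s32] at m3
  rcases lt_or_gt_of_ne c12 with g12 | g12 <;> rcases lt_or_gt_of_ne c23 with g23 | g23 <;>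
    rcases lt_or_gt_of_ne c13 with g13 | g13
  · exact m2 (mul_pos_of_neg_of_neg g12 g13) (mul_pos_of_neg_of_neg g23 g13)
  · have := mul_neg_of_neg_of_pos g23 i1
    have := mul_pos g13 i2
    have := mul_neg_of_neg_of_pos g12 i3
    linarith
  · exact m3 (mul_pos_of_neg_of_neg g13 g12) (mul_pos_of_neg_of_neg (by linarith) g12)
  · exact m1 (mul_pos (by linarith) g23) (mul_pos g13 g23)
  · exact m1 (mul_pos_of_neg_of_neg (by linarith) g23) (mul_pos_of_neg_of_neg g13 g23)
  · exact m3 (mul_pos g13 g12) (mul_pos (by linarith) g12)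
  · have := mul_pos g23 i1
    have := mul_neg_of_neg_of_pos g13 i2
    have := mul_pos g12 i3
    linarith
  · exact m2 (mul_pos g12 g13) (mul_pos g23 g13)

end

/-! ### The three bounds and the theorem. -/

theorem two_mul_ncard_le_card_darts {X V : Finset Plane} {d : ℝ} (hd : 0 < d) (hVX : V ⊆ X)
    (h : ∀ p ∈ X, ∀ q ∈ X, dist p q = d → p ∈ V) :
    2 * multiplicityOfDistance X d ≤ (darts V (DistAdj V d)).card := by
  classical
  have hmem : ∀ e : Plane × Plane, e ∈ darts V (DistAdj V d) ↔ DistAdj V d e.1 e.2 := by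
    intro e
    simp only [darts, Finset.mem_filter, Finset.mem_product, and_iff_right_iff_imp]
    exact fun he => ⟨he.1, he.2.1⟩
  have himg : pairsAtDistance X d =
      ((darts V (DistAdj V d)).image fun e => s(e.1, e.2) : Finset (Sym2 Plane)) := by
    ext e
    simp only [pairsAtDistance, Set.mem_ofPred_eq, Finset.coe_image, Set.mem_image,
      Finset.mem_coe, hmem]
    constructor
    · rintro ⟨p, hp, q, hq, -, hpq, rfl⟩
      exact ⟨(p, q), ⟨h p hp q hq hpq, h q hq p hp (by rw [dist_comm]; exact hpq), hpq⟩, rfl⟩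
    · rintro ⟨⟨p, q⟩, hpq, rfl⟩
      exact ⟨p, hVX hpq.1, q, hVX hpq.2.1, ne_of_dist_eq hd hpq.2.2, hpq.2.2, rfl⟩
  rw [multiplicityOfDistance, himg, Set.ncard_coe_finset]
  refine Finset.mul_card_image_le_card _ 2 fun b hb => ?_
  obtain ⟨e, he, rfl⟩ := Finset.mem_image.1 hb
  have he' := (hmem e).1 he
  have hne : e ≠ e.swap := by
    intro h'
    exact ne_of_dist_eq hd he'.2.2 (congrArg Prod.fst h')
  refine (Finset.card_pair hne).symm.trans_le (Finset.card_le_card fun f hf => ?_)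
  rcases Finset.mem_insert.1 hf with rfl | hf
  · exact Finset.mem_filter.2 ⟨he, rfl⟩
  · rw [Finset.mem_singleton] at hf
    subst hf
    exact Finset.mem_filter.2 ⟨(hmem _).2 he'.symm, Sym2.eq_swap⟩

/-- The three bounds on the number of pairs at the second largest distance, in terms of the sizes
of the two outer layers. -/
theorem multiplicity_bounds {X : Finset Plane} {d D : ℝ} (hd : 0 < d) (hdD : d < D)
    (hX : ∀ x ∈ X, ∀ y ∈ X, dist x y ≤ d ∨ dist x y = D)
    (hcard : (firstLayer (X : Set Plane)).ncard + 2 ≤ X.card) :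
    2 * multiplicityOfDistance X d ≤
        3 * ((firstLayer (X : Set Plane)).ncard + (secondLayer (X : Set Plane)).ncard) ∧
      3 * multiplicityOfDistance X d ≤
        4 * (firstLayer (X : Set Plane)).ncard + 6 * (secondLayer (X : Set Plane)).ncard ∧
      multiplicityOfDistance X d ≤
        2 * (firstLayer (X : Set Plane)).ncard + (secondLayer (X : Set Plane)).ncard := by
  classical
  have hfin1 : (firstLayer (X : Set Plane)).Finite := X.finite_toSet.subset (firstLayer_subset _)
  have hsub2 : secondLayer (X : Set Plane) ⊆ (X : Set Plane) \ firstLayer X := firstLayer_subset _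
  have hfin2 : (secondLayer (X : Set Plane)).Finite :=
    X.finite_toSet.subset (hsub2.trans Set.sdiff_subset)
  obtain ⟨A, hA⟩ : ∃ A : Finset Plane, (A : Set Plane) = firstLayer X :=
    ⟨hfin1.toFinset, hfin1.coe_toFinset⟩
  obtain ⟨B, hB⟩ : ∃ B : Finset Plane, (B : Set Plane) = secondLayer X :=
    ⟨hfin2.toFinset, hfin2.coe_toFinset⟩
  have memA : ∀ {x}, x ∈ A ↔ x ∈ firstLayer (X : Set Plane) := by
    intro x; rw [← hA, Finset.mem_coe]
  have memB : ∀ {x}, x ∈ B ↔ x ∈ secondLayer (X : Set Plane) := by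
    intro x; rw [← hB, Finset.mem_coe]
  rw [← hA, ← hB, Set.ncard_coe_finset, Set.ncard_coe_finset]
  rw [← hA, Set.ncard_coe_finset] at hcard
  have hAX : A ⊆ X := fun x hx => firstLayer_subset _ (memA.1 hx)
  have hBX : B ⊆ X := fun x hx => (hsub2 (memB.1 hx)).1
  have hBA : ∀ {x}, x ∈ B → x ∉ firstLayer (X : Set Plane) := fun hx => (hsub2 (memB.1 hx)).2
  -- The `+ 2` in `hcard` supplies two inner points, hence one different from `p`.
  have hinner : ∀ p : Plane, ∃ z ∈ X, z ∉ firstLayer (X : Set Plane) ∧ p ≠ z := by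
    intro p
    have h1 : 1 < (X \ A).card := by
      have := Finset.card_sdiff_add_card_eq_card hAX
      omega
    obtain ⟨z, hz, hzp⟩ := Finset.exists_mem_ne h1 p
    rw [Finset.mem_sdiff, memA] at hz
    exact ⟨z, hz.1, hz.2, hzp.symm⟩
  have hVX : A ∪ B ⊆ X := Finset.union_subset hAX hBX
  have hends : ∀ p ∈ X, ∀ q ∈ X, dist p q = d → p ∈ A ∪ B := by
    intro p hp q hq hpq
    rw [Finset.mem_union, memA, memB]
    by_cases h : p ∈ firstLayer (X : Set Plane)
    · exact Or.inl h
    · exact Or.inr (layers_of_dist_eq hdD hX hp hq hpq h).1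
  have hV : ∀ x ∈ A ∪ B, ∀ y ∈ A ∪ B, dist x y ≤ d ∨ dist x y = D :=
    fun x hx y hy => hX x (hVX hx) y (hVX hy)
  have toX : ∀ {q r}, DistAdj (A ∪ B) d q r → DistAdj X d q r :=
    fun h => ⟨hVX h.1, hVX h.2.1, h.2.2⟩
  have hIX : ∀ {q}, q ∈ A → ConvexIndepAt (X : Set Plane) q :=
    fun hq => convexIndepAt_of_mem_firstLayer (memA.1 hq)
  have hdeg : ∀ q ∈ B, ∀ r a c, DistAdj (A ∪ B) d q r → DistAdj (A ∪ B) d q a →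
      DistAdj (A ∪ B) d q c → r = a ∨ a = c ∨ r = c := by
    intro q hq r a c hr ha hc
    obtain ⟨z, hz, hzL, hqz⟩ := hinner q
    by_contra! hne
    exact no_three_neighbors_of_inner_points hd hdD hX (hBX hq) (hBA hq) hz hzL hqz (toX hr)
      (toX ha) (toX hc) hne.1 hne.2.1 hne.2.2
  have hR : RightOrder (A ∪ B) (DistAdj (A ∪ B) d) (RightOf 1) := by
    refine rightOrder_distAdj hd (by norm_num) hV fun q hq => ?_
    rcases Finset.mem_union.1 hq with hqA | hqB
    · exact Or.inl ((hIX hqA).mono (Finset.coe_subset.2 hVX))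
    · refine Or.inr ⟨fun r a hr ha hne => ?_, hdeg q hqB⟩
      obtain ⟨z, hz, hzL, hqz⟩ := hinner q
      exact cr_ne_zero_of_inner_points hdD hX hz hzL hqz (toX hr) (toX ha) hne
  have hcover : ∀ {q r}, DistAdj (A ∪ B) d q r → q ∈ A ∨ r ∈ A := by
    intro q r h
    by_cases hq : q ∈ A
    · exact Or.inl hq
    · rw [memA] at hq ⊢
      exact Or.inr (memA.2 (layers_of_dist_eq hdD hX (hVX h.1) (hVX h.2.1) h.2.2 hq).2)
  have hM := two_mul_ncard_le_card_darts hd hVX hends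
  have hcardV := Finset.card_union_le A B
  have hdarts := hR.card_darts_le
  have hzig := hR.card_zigDarts_le
  have hzig' := hR.card_zigDarts_le_of_cover hcover
  refine ⟨by omega, ?_, by omega⟩
  have hAA := card_darts_le_of_convexIndep hd hdD (V := A)
    (fun x hx y hy => hX x (hAX hx) y (hAX hy))
    (fun q hq => (hIX hq).mono (Finset.coe_subset.2 hAX))
  -- Darts leaving the second layer, at most two per point; up to reversal, all others stay in the
  -- first layer, where the convex bound applies.
  set T := (darts (A ∪ B) (DistAdj (A ∪ B) d)).filter fun e => e.1 ∈ B with hT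
  have hTB : T.card ≤ 2 * B.card := by
    refine Finset.card_le_mul_card_image_of_maps_to (f := Prod.fst)
      (fun e he => (Finset.mem_filter.1 he).2) 2 fun q hq => ?_
    by_contra! h
    obtain ⟨x, y, z, hx, hy, hz, hxy, hxz, hyz⟩ := Finset.two_lt_card_iff.1 h
    have aux : ∀ {e : Plane × Plane}, e ∈ T.filter (fun a => a.1 = q) →
        e.1 = q ∧ DistAdj (A ∪ B) d q e.2 := by
      intro e he
      obtain ⟨heT, rfl⟩ := Finset.mem_filter.1 he
      exact ⟨rfl, (mem_darts hR).1 (Finset.mem_filter.1 heT).1⟩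
    obtain ⟨x1, hx⟩ := aux hx
    obtain ⟨y1, hy⟩ := aux hy
    obtain ⟨z1, hz⟩ := aux hz
    rcases hdeg q hq _ _ _ hx hy hz with h' | h' | h'
    · exact hxy (Prod.ext (x1.trans y1.symm) h')
    · exact hyz (Prod.ext (y1.trans z1.symm) h')
    · exact hxz (Prod.ext (x1.trans z1.symm) h')
  have hsplit : darts (A ∪ B) (DistAdj (A ∪ B) d) ⊆
      darts A (DistAdj A d) ∪ (T ∪ T.image Prod.swap) := by
    intro e he
    have he' := (mem_darts hR).1 he
    by_cases h1 : e.1 ∈ B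
    · exact Finset.mem_union_right _ (Finset.mem_union_left _ (Finset.mem_filter.2 ⟨he, h1⟩))
    · by_cases h2 : e.2 ∈ B
      · refine Finset.mem_union_right _ (Finset.mem_union_right _ (Finset.mem_image.2
          ⟨e.swap, Finset.mem_filter.2 ⟨(mem_darts hR).2 he'.symm, h2⟩, Prod.swap_swap e⟩))
      · have a1 := (Finset.mem_union.1 he'.1).resolve_right h1
        have a2 := (Finset.mem_union.1 he'.2.1).resolve_right h2
        refine Finset.mem_union_left _ ?_
        rw [darts, Finset.mem_filter, Finset.mem_product]
        exact ⟨⟨a1, a2⟩, a1, a2, he'.2.2⟩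
  have h1 := Finset.card_le_card hsplit
  have h2 := Finset.card_union_le (darts A (DistAdj A d)) (T ∪ T.image Prod.swap)
  have h3 := Finset.card_union_le T (T.image Prod.swap)
  have h4 : (T.image Prod.swap).card ≤ T.card := Finset.card_image_le
  omega

theorem theorem2 (n : ℕ) (hn : 2 ≤ n) (X : Finset Plane) (hX : X.card = n)
    (hmin : min (min
        ((3 / 2 : ℝ) * (((firstLayer X).ncard : ℝ) + ((secondLayer X).ncard : ℝ)))
        ((4 / 3 : ℝ) * ((firstLayer X).ncard : ℝ) + 2 * ((secondLayer X).ncard : ℝ)))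
        (2 * ((firstLayer X).ncard : ℝ) + ((secondLayer X).ncard : ℝ)) ≤ (n : ℝ))
    (d : ℝ) (hd : IsSecondLargestDistance X d) :
    multiplicityOfDistance X d ≤ n := by
  obtain ⟨D, hD, hdm⟩ := hd
  have hdD : d < D := lt_of_le_of_ne (hD.2 hdm.1.1) hdm.1.2
  have hd0 : 0 < d := by
    obtain ⟨p, -, q, -, hpq, rfl⟩ := hdm.1.1
    exact dist_pos.2 hpq
  have hdist : ∀ x ∈ X, ∀ y ∈ X, dist x y ≤ d ∨ dist x y = D := by
    intro x hx y hy
    by_cases hxy : x = y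
    · left; rw [hxy, dist_self]; exact hd0.le
    · by_cases h : dist x y = D
      · exact Or.inr h
      · exact Or.inl (hdm.2 ⟨⟨x, hx, y, hy, hxy, rfl⟩, h⟩)
  have hfin1 : (firstLayer (X : Set Plane)).Finite := X.finite_toSet.subset (firstLayer_subset _)
  have hsub2 : secondLayer (X : Set Plane) ⊆ (X : Set Plane) \ firstLayer X := firstLayer_subset _
  have hfin2 : (secondLayer (X : Set Plane)).Finite :=
    X.finite_toSet.subset (hsub2.trans Set.sdiff_subset)
  have ha : 2 ≤ (firstLayer (X : Set Plane)).ncard := by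
    obtain ⟨p, hp, q, hq, hpq, hpqD⟩ := hD.1
    have h1 := mem_firstLayer_of_dist_eq hdD hdist hp hq hpqD
    have h2 := mem_firstLayer_of_dist_eq hdD hdist hq hp (by rw [dist_comm]; exact hpqD)
    rw [← Set.ncard_pair hpq]
    exact Set.ncard_le_ncard (Set.insert_subset h1 (Set.singleton_subset_iff.2 h2)) hfin1
  have hb : (firstLayer (X : Set Plane)).ncard < n → 1 ≤ (secondLayer (X : Set Plane)).ncard := by
    intro h
    rw [Nat.one_le_iff_ne_zero, ← Nat.pos_iff_ne_zero, Set.ncard_pos hfin2]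
    refine firstLayer_nonempty (X.finite_toSet.subset Set.sdiff_subset) ?_
    by_contra hne
    rw [Set.not_nonempty_iff_eq_empty, Set.sdiff_eq_empty] at hne
    have := Set.ncard_le_ncard hne hfin1
    rw [Set.ncard_coe_finset] at this
    omega
  obtain ⟨a, hadef⟩ : ∃ a, a = (firstLayer (X : Set Plane)).ncard := ⟨_, rfl⟩
  obtain ⟨b, hbdef⟩ : ∃ b, b = (secondLayer (X : Set Plane)).ncard := ⟨_, rfl⟩
  have hbounds := multiplicity_bounds hd0 hdD hdist
  rw [← hadef] at ha hb hmin hbounds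
  rw [← hbdef] at hb hmin hbounds
  have hcases : 3 * (a + b) ≤ 2 * n ∨ 4 * a + 6 * b ≤ 3 * n ∨ 2 * a + b ≤ n := by
    rcases min_le_iff.1 hmin with h | h
    · rcases min_le_iff.1 h with h | h
      · left
        have : (3 * (a + b) : ℝ) ≤ 2 * n := by linarith
        exact_mod_cast this
      · right; left
        have : (4 * a + 6 * b : ℝ) ≤ 3 * n := by linarith
        exact_mod_cast this
    · right; right
      exact_mod_cast h
  have hlt : a < n := by omega
  have hb1 := hb hlt
  -- With b ≥ 1, each alternative of `hcases` excludes n = a + 1, so there are two inner points.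
  obtain ⟨h1, h2, h3⟩ := hbounds (by omega)
  omega
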